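/- Let $f,F:\mathbb{R}^n\to\mathbb{R}$ be locally Lipschitz, let $\partial$ denote the Clarke subdifferential, and consider $\min f(x)$ s.t. $F(x)\le 0$. Norms $|\cdot|$ are Euclidean norms of vectors and spectral norms of matrices. Matrices are real symmetric $n\times n$; a "positive definite modification" of a matrix may be any symmetric positive definite matrix. **Algorithm.** Parameters: tolerance $\varepsilon=0$; $M\ge2$; $t_0,\hat t_0\in(0,1)$; $m_L\in(0,\frac12)$, $m_R\in(m_L,1)$, $m_f\in[0,1]$, $m_F\in(0,1)$; $\zeta\in(0,\frac12)$, $\vartheta\ge1$; $C_S,C_G,\hat C_G,\bar C_G,\bar{\hat C}_G>0$; $i_\rho,i_l,i_m,i_r\in\mathbb{N}_0$; $\gamma_1,\gamma_2>0$; $\omega_1,\omega_2\ge1$. For every point $y$ subgradients $g(y)\in\partial f(y)$, $\hat g(y)\in\partial F(y)$ are available, and symmetric matrices $G$, $\hat G$ (approximate second order information of arbitrary quality, which may depend on the iteration) at $y$; $g_j=g(y_j)$, $\hat g_j=\hat g(y_j)$, and $G_j,\hat G_j$ are the matrices at $y_j$. *Initialization.* $x_1=y_1$ with $F(x_1)<0$;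 $J_1=\{1\}$; $i_n=i_s=0$; $f_p^1=f_1^1=f(y_1)$, $g_p^1=g_1^1=g_1$, $G_p^1=G_1$, $F_p^1=F_1^1=F(y_1)$, $\hat g_p^1=\hat g_1^1=\hat g_1$, $\hat G_p^1=\hat G_1$, $s_1^1=s_p^1=\hat s_p^1=0$, $\rho_1=\hat\rho_1=1$, $\bar\kappa^1=1$. Iteration $k=1,2,\dots$: 1. *Matrices.* $W=G_k+\bar\kappa^k\hat G_k$ if steps $k-1$ and $k-2$ exist and were serious and ($\lambda_{k-1}^{k-1}=1$ or $i_s>i_r$); otherwise $W=G_p^k+\bar\kappa^k\hat G_p^k$. If $i_n\le i_m+i_l$, $\overline W_p^k$ is a positive definite modification of $W$, else $\overline W_p^k=\overline W_p^{k-1}$. If $i_n\le i_m+i_l$, $\overline G^k,\overline{\hat G}{}^k$ are positive definite modifications of $G_p^k,\hat G_p^k$, else $\overline G^k=\overline G^{k-1}$, $\overline{\hat G}{}^k=\overline{\hat G}{}^{k-1}$. For $j\in J_k$: if $i_n<i_m+i_l$, $\overline G_j^k,\overline{\hat G}{}_j^k$ are positive definite modifications of $G_j,\hat G_j$, else $\overline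 G_j^k=\overline G^k$, $\overline{\hat G}{}_j^k=\overline{\hat G}{}^k$. Always $|\overline G_j^k|,|\overline G^k|\le\bar C_G$ and $|\overline{\hat G}{}_j^k|,|\overline{\hat G}{}^k|\le\bar{\hat C}_G$. 2. *Errors.* $\alpha_j^k=\max(|f(x_k)-f_j^k|,\gamma_1(s_j^k)^{\omega_1})$, $\alpha_p^k=\max(|f(x_k)-f_p^k|,\gamma_1(s_p^k)^{\omega_1})$, $A_j^k=\max(|F(x_k)-F_j^k|,\gamma_2(s_j^k)^{\omega_2})$, $A_p^k=\max(|F(x_k)-F_p^k|,\gamma_2(\hat s_p^k)^{\omega_2})$. 3. *Search direction.* $(d_k,\hat v_k)$ minimizes $\hat v+\frac12d^T\overline W_p^kd$ over $(d,\hat v)\in\mathbb{R}^{n+1}$ subject to $-\alpha_j^k+d^Tg_j^k+\frac12d^T\overline G_j^kd\le\hat v$ and $F(x_k)-A_j^k+d^T\hat g_j^k+\frac12d^T\overline{\hat G}{}_j^kd\le0$ for $j\in J_k$ and, if $i_s\le i_r$, also $-\alpha_p^k+d^Tg_p^k+\frac12d^T\overline G^kd\le\hat v$ and $F(x_k)-A_p^k+d^T\hat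 g_p^k+\frac12d^T\overline{\hat G}{}^kd\le0$. Let $\lambda_j^k,\lambda_p^k$ (objective) and $\mu_j^k,\mu_p^k$ (constraint) be associated nonnegative Lagrange (KKT) multipliers, zero for constraints that are not present. Put $$B_k=\sum_{j\in J_k}(\lambda_j^k\overline G_j^k+\mu_j^k\overline{\hat G}{}_j^k)+\lambda_p^k\overline G^k+\mu_p^k\overline{\hat G}{}^k,\qquad H_k=(\overline W_p^k+B_k)^{-1/2},\qquad\bar\kappa^{k+1}=\sum_{j\in J_k}\mu_j^k+\mu_p^k,$$ and $(\kappa_j^k,\kappa_p^k)=(\mu_j^k,\mu_p^k)/\bar\kappa^{k+1}$ if $\bar\kappa^{k+1}>0$, $=0$ otherwise. If $i_s>i_r$, reset $i_s=0$. 4. *Aggregation.* $(\tilde g_p^k,\tilde f_p^k,G_p^{k+1},\tilde s_p^k)=\sum_{j\in J_k}\lambda_j^k(g_j^k,f_j^k,\rho_jG_j,s_j^k)+\lambda_p^k(g_p^k,f_p^k,G_p^k,s_p^k)$ and $(\tilde{\hat g}_p^k,\tilde F_p^k,\hat G_p^{k+1},\tilde{\hat s}_p^k)=\sum_{j\in J_k}\kappa_j^k(\hat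 g_j^k,F_j^k,\hat\rho_j\hat G_j,s_j^k)+\kappa_p^k(\hat g_p^k,F_p^k,\hat G_p^k,\hat s_p^k)$; $\tilde\alpha_p^k=\max(|f(x_k)-\tilde f_p^k|,\gamma_1(\tilde s_p^k)^{\omega_1})$, $\tilde A_p^k=\max(|F(x_k)-\tilde F_p^k|,\gamma_2(\tilde{\hat s}_p^k)^{\omega_2})$; $$v_k=-d_k^T\overline W_p^kd_k-\tfrac12d_k^TB_kd_k-\tilde\alpha_p^k-\bar\kappa^{k+1}\tilde A_p^k-\bar\kappa^{k+1}(-F(x_k)),$$ $$w_k=\tfrac12\bigl|H_k(\tilde g_p^k+\bar\kappa^{k+1}\tilde{\hat g}_p^k)\bigr|^2+\tilde\alpha_p^k+\bar\kappa^{k+1}\tilde A_p^k+\bar\kappa^{k+1}(-F(x_k)).$$ 5. *Termination.* Stop if $w_k\le\varepsilon$. 6. *Line search* (below) gives $t_L^k,t_R^k,t_0^k$; $x_{k+1}=x_k+t_L^kd_k$, $y_{k+1}=x_k+t_R^kd_k$. The step is serious if $t_L^k\ge t_0^k$. 7. *Update.* $\rho_{k+1}=\min(1,C_G/|G_{k+1}|)$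 if $i_n\le i_\rho$, else $\rho_{k+1}=0$; $\hat\rho_{k+1}=\min(1,\hat C_G/|\hat G_{k+1}|)$ (where $C/0=\infty$). After a serious step $i_n$ becomes $0$ and $i_s$ becomes $i_s+1$; otherwise $i_n$ becomes $i_n+1$. With $\Delta=x_{k+1}-x_k$, $\delta=x_{k+1}-y_{k+1}$ and for $1\le j\le k$: $s_j^{k+1}=s_j^k+|\Delta|$, $s_{k+1}^{k+1}=|\delta|$, $s_p^{k+1}=\tilde s_p^k+|\Delta|$, $\hat s_p^{k+1}=\tilde{\hat s}_p^k+|\Delta|$; $f_j^{k+1}=f_j^k+(g_j^k)^T\Delta+\frac12\rho_j\Delta^TG_j\Delta$, $f_{k+1}^{k+1}=f(y_{k+1})+g_{k+1}^T\delta+\frac12\rho_{k+1}\delta^TG_{k+1}\delta$, $f_p^{k+1}=\tilde f_p^k+(\tilde g_p^k)^T\Delta+\frac12\Delta^TG_p^{k+1}\Delta$; $g_j^{k+1}=g_j^k+\rho_jG_j\Delta$, $g_{k+1}^{k+1}=g_{k+1}+\rho_{k+1}G_{k+1}\delta$, $g_p^{k+1}=\tilde g_p^k+G_p^{k+1}\Delta$;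 and likewise for $F$, with $F_\cdot,\hat g_\cdot,\hat G_\cdot,\hat\rho_\cdot,\tilde F_p^k,\tilde{\hat g}_p^k$ in place of $f_\cdot,g_\cdot,G_\cdot,\rho_\cdot,\tilde f_p^k,\tilde g_p^k$. Choose $J_{k+1}\subseteq\{k-M+2,\dots,k+1\}\cap\{1,2,\dots\}$ with $k+1\in J_{k+1}$. *Line search* (with $x=x_k$, $d=d_k$, $v=v_k$). Start with $t_L=0$, $t=t_U=1$ and $t_0$ the given parameter. (a) If $F(x+td)<0$ and $f(x+td)\le f(x)+m_Lvt$, set $t_L=t$; if $F(x+td)<0$ and $f(x+td)>f(x)+m_Lvt$, set $t_U=t$; if $F(x+td)\ge0$, set $t_U=t$ and $t_0=\hat t_0t_U$. If $t_L\ge t_0$, return $t_L$, $t_R=t_L$, $t_0$. (b) Return $t_L$, $t_R=t$, $t_0$ if $F(x+td)<0$ and $Z$ holds, or if $i_n<i_l$, $F(x+td)\ge0$ and $\hat Z$ holds. (c) Choose $t\in[t_L+\zeta(t_U-t_L)^\vartheta,\,t_U-\zeta(t_U-t_L)^\vartheta]$ and go to (a). Here, with $g,G,\rho$ formed at $y=x+td$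 as $g_{k+1},G_{k+1},\rho_{k+1}$ are formed at $y_{k+1}$, $\overline G$ a positive definite modification of $G$, $\phi=f(y)+(t_L-t)g^Td+\frac12\rho(t_L-t)^2d^TGd$ and $\beta=\max(|f(x+t_Ld)-\phi|,\gamma_1|t_L-t|^{\omega_1}|d|^{\omega_1})$, $Z$ means: $-\beta+d^T(g+\rho(t_L-t)Gd)\ge m_Rv-\frac12m_fd^T\overline Gd$ and $(t-t_L)|d|\le C_S$. With the analogous quantities $\hat g,\hat G,\hat\rho,\overline{\hat G},\hat\beta$ for $F,\gamma_2,\omega_2$, $\hat Z$ means: $F(x+t_Ld)-\hat\beta+d^T(\hat g+\hat\rho(t_L-t)\hat Gd)\ge-\frac12m_Fd^T\overline{\hat G}d$ and $(t-t_L)|d|\le C_S$. **Proposition.** Assume that the algorithm does not terminate (all iterations $k\ge1$ are carried out, and $w_k>0$ for all $k\ge1$), that $\{(x_k,\bar\kappa^{k+1})\}_{k\ge1}$ is bounded, and that $\{(\overline W_p^k)^{-1/2}\}_{k\ge1}$ is uniformly positive definite, i.e. there is $c>0$ with $z^T(\overline W_p^k)^{-1/2}z\ge c|z|^2$ for all $k\ge1$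 and $z\in\mathbb{R}^n$. If $\bar x\in\mathbb{R}^n$ satisfies $$\sigma(\bar x):=\liminf_{k\to\infty}\max(w_k,|x_k-\bar x|)=0,$$ then there exists $\bar\kappa\ge0$ with $$0\in\partial f(\bar x)+\bar\kappa\,\partial F(\bar x),\qquad\bar\kappa F(\bar x)=0,\qquad F(\bar x)\le0.$$ -/

import Mathlib

open Filter Topology
open scoped Pointwise MatrixOrder

/-! ### Vectors and matrices -/

/-- `ℝⁿ` with the Euclidean norm. -/
abbrev Vec (n : ℕ) : Type := EuclideanSpace ℝ (Fin n)

/-- Real `n × n` matrices. -/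
abbrev Mat (n : ℕ) : Type := Matrix (Fin n) (Fin n) ℝ

/-- The matrix-vector product `A v`. -/
noncomputable def Mat.app {n : ℕ} (A : Mat n) (v : Vec n) : Vec n :=
  Matrix.toEuclideanCLM (n := Fin n) (𝕜 := ℝ) A v

/-- The quadratic form `vᵀ A v`. -/
noncomputable def Mat.quad {n : ℕ} (A : Mat n) (v : Vec n) : ℝ :=
  inner ℝ v (A.app v)

/-- The spectral norm of a matrix (operator norm for the Euclidean norm). -/
noncomputable def Mat.specNorm {n : ℕ} (A : Mat n) : ℝ :=
  ‖Matrix.toEuclideanCLM (n := Fin n) (𝕜 := ℝ) A‖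

/-- `A^(-1/2)` for a positive definite matrix `A`: the inverse of the positive square root. -/
noncomputable def Mat.invSqrt {n : ℕ} (A : Mat n) : Mat n :=
  (CFC.sqrt A)⁻¹

/-- The matrices `A 1, A 2, …` are uniformly positive definite. -/
def UniformlyPosDef {n : ℕ} (A : ℕ → Mat n) : Prop :=
  ∃ c : ℝ, 0 < c ∧ ∀ k, 1 ≤ k → ∀ z : Vec n, c * ‖z‖ ^ 2 ≤ (A k).quad z

/-- `B` is a positive definite modification of `A`. No rule that produces `B` out of `A` is
prescribed (the Gill-Murray factorization is one possibility); all that is required of the result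
is that it is symmetric and positive definite. -/
def IsPosDefModification {n : ℕ} (_A B : Mat n) : Prop := B.PosDef

/-! ### Nonsmooth analysis -/

/-- The Clarke directional derivative
`f⁰(x, d) = limsup_{h → 0, t ↓ 0} (f (x + h + t d) - f (x + h)) / t`
(for locally Lipschitz `f`, where the difference quotient is locally bounded). -/
noncomputable def clarkeDeriv {n : ℕ} (f : Vec n → ℝ) (x d : Vec n) : ℝ :=
  limsup (fun p : Vec n × ℝ => (f (x + p.1 + p.2 • d) - f (x + p.1)) / p.2)
    (𝓝 (0 : Vec n) ×ˢ 𝓝[>] (0 : ℝ))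

/-- The (Clarke) subdifferential of `f` at `x`. -/
def subdifferential {n : ℕ} (f : Vec n → ℝ) (x : Vec n) : Set (Vec n) :=
  convexHull ℝ {g : Vec n | ∀ d : Vec n, inner ℝ g d ≤ clarkeDeriv f x d}

/-- The first order optimality system for `min f(x) s.t. F(x) ≤ 0` at `x` with multiplier `κ`. -/
def IsStationaryWith {n : ℕ} (f F : Vec n → ℝ) (x : Vec n) (κ : ℝ) : Prop :=
  (0 : Vec n) ∈ subdifferential f x + κ • subdifferential F x ∧ κ * F x = 0 ∧ F x ≤ 0

/-! ### The input of the algorithm -/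

/-- The parameters, which are not changed during the algorithm. -/
structure Parameters where
  /-- final optimality tolerance -/
  eps : ℝ
  /-- maximal bundle dimension -/
  M : ℕ
  /-- initial lower bound for the step size of serious steps in the line search -/
  t₀ : ℝ
  /-- scaling parameter for `t₀` -/
  t₀hat : ℝ
  /-- descent parameter for serious steps -/
  mL : ℝ
  /-- parameters for the change of the model of the objective function -/
  mR : ℝ
  mf : ℝ
  /-- parameter for the change of the model of the constraint -/
  mF : ℝ
  /-- coefficient and exponent for the interpolation in the line search -/
  ζ : ℝ
  ϑ : ℝ
  /-- upper bound of the distance between `x_k` and `y_k` -/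
  CS : ℝ
  /-- upper bounds for the norms of the damped matrices (objective, constraint) -/
  CG : ℝ
  CGhat : ℝ
  /-- upper bounds for the norms of the positive definite matrices in the quadratic constraints
  of the search direction problem (objective, constraint) -/
  CGbar : ℝ
  CGbarhat : ℝ
  /-- selection parameter for the damping parameter `ρ` -/
  iρ : ℕ
  /-- line search selection parameter -/
  il : ℕ
  /-- matrix selection parameter -/
  im : ℕ
  /-- bundle reset parameter -/
  ir : ℕ
  /-- coefficients and exponents for the locality measures (objective, constraint) -/
  γ₁ : ℝ
  γ₂ : ℝ
  ω₁ : ℝ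
  ω₂ : ℝ

/-- The admissible ranges of the parameters. -/
structure Parameters.Valid (P : Parameters) : Prop where
  eps_nonneg : 0 ≤ P.eps
  two_le_M : 2 ≤ P.M
  t₀_mem : P.t₀ ∈ Set.Ioo (0 : ℝ) 1
  t₀hat_mem : P.t₀hat ∈ Set.Ioo (0 : ℝ) 1
  mL_mem : P.mL ∈ Set.Ioo (0 : ℝ) (1 / 2)
  mR_mem : P.mR ∈ Set.Ioo P.mL 1
  mf_mem : P.mf ∈ Set.Icc (0 : ℝ) 1
  mF_mem : P.mF ∈ Set.Ioo (0 : ℝ) 1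
  ζ_mem : P.ζ ∈ Set.Ioo (0 : ℝ) (1 / 2)
  one_le_ϑ : 1 ≤ P.ϑ
  CS_pos : 0 < P.CS
  CG_pos : 0 < P.CG
  CGhat_pos : 0 < P.CGhat
  CGbar_pos : 0 < P.CGbar
  CGbarhat_pos : 0 < P.CGbarhat
  γ₁_pos : 0 < P.γ₁
  γ₂_pos : 0 < P.γ₂
  one_le_ω₁ : 1 ≤ P.ω₁
  one_le_ω₂ : 1 ≤ P.ω₂

/-- What is evaluated at trial points: subgradients `g(y)`, `ĝ(y)` of the objective and the
constraint, and, at iteration `k`, symmetric matrices `G k y`, `Ghat k y` that serve as approximate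
second order information at `y`, together with the positive definite modifications of them that
the line search uses. -/
structure Oracle (n : ℕ) where
  g : Vec n → Vec n
  ghat : Vec n → Vec n
  G : ℕ → Vec n → Mat n
  Ghat : ℕ → Vec n → Mat n
  Gbar : ℕ → Vec n → Mat n
  Gbarhat : ℕ → Vec n → Mat n

/-- The oracle belongs to the functions `f` and `F`. The quality of the approximation of second
order information is not restricted. -/
structure Oracle.Valid {n : ℕ} (O : Oracle n) (f F : Vec n → ℝ) : Prop where
  g_mem : ∀ y, O.g y ∈ subdifferential f y
  ghat_mem : ∀ y, O.ghat y ∈ subdifferential F y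
  G_symm : ∀ k y, (O.G k y).IsSymm
  Ghat_symm : ∀ k y, (O.Ghat k y).IsSymm
  Gbar_mod : ∀ k y, IsPosDefModification (O.G k y) (O.Gbar k y)
  Gbarhat_mod : ∀ k y, IsPosDefModification (O.Ghat k y) (O.Gbarhat k y)

/-- The damping factor `min (1, C / |A|)`, which is `1` for `A = 0`. -/
noncomputable def damping {n : ℕ} (C : ℝ) (A : Mat n) : ℝ :=
  if A.specNorm = 0 then 1 else min 1 (C / A.specNorm)

/-- Damping factor for the objective: switched off after more than `iρ` subsequent null and short
steps. -/
noncomputable def objDamping {n : ℕ} (P : Parameters) (iN : ℕ) (A : Mat n) : ℝ :=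
  if iN ≤ P.iρ then damping P.CG A else 0

/-- `max (|r|, γ s^ω)`. -/
noncomputable def locError (γ ω r s : ℝ) : ℝ := max |r| (γ * s ^ ω)

/-! ### The line search -/

/-- The data a line search is called with: the iteration index `k`, the number `iN` of
subsequent null and short steps, the iteration point `x`, the search direction `d`, and the
predicted descent `v`. -/
structure LineSearchInput (n : ℕ) where
  k : ℕ
  iN : ℕ
  x : Vec n
  d : Vec n
  v : ℝ

/-- The variables of the line search. -/
structure LineSearchState where
  tL : ℝ
  tU : ℝ
  t₀ : ℝ
  t : ℝ

/-- Step 1 of the line search: modification of either `tL` or `tU`. -/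
noncomputable def LineSearchInput.modify {n : ℕ} (L : LineSearchInput n) (P : Parameters)
    (f F : Vec n → ℝ) (S : LineSearchState) : LineSearchState :=
  if F (L.x + S.t • L.d) < 0 then
    if f (L.x + S.t • L.d) ≤ f L.x + P.mL * L.v * S.t then { S with tL := S.t }
    else { S with tU := S.t }
  else { S with tU := S.t, t₀ := P.t₀hat * S.t }

/-- The condition `Z`: the trial point changes the model of the objective sufficiently. -/
def LineSearchInput.ObjectiveTest {n : ℕ} (L : LineSearchInput n) (P : Parameters)
    (f : Vec n → ℝ) (O : Oracle n) (S : LineSearchState) : Prop :=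
  let y : Vec n := L.x + S.t • L.d
  let g : Vec n := O.g y
  let G : Mat n := O.G L.k y
  let ρ : ℝ := objDamping P L.iN G
  let fval : ℝ := f y + (S.tL - S.t) * inner ℝ g L.d
    + 1 / 2 * ρ * (S.tL - S.t) ^ 2 * G.quad L.d
  let β : ℝ := max |f (L.x + S.tL • L.d) - fval|
    (P.γ₁ * |S.tL - S.t| ^ P.ω₁ * ‖L.d‖ ^ P.ω₁)
  P.mR * L.v + P.mf * (-(1 / 2) * (O.Gbar L.k y).quad L.d)
      ≤ -β + inner ℝ L.d (g + (ρ * (S.tL - S.t)) • G.app L.d) ∧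
    (S.t - S.tL) * ‖L.d‖ ≤ P.CS

/-- The condition `Ẑ`: the trial point changes the model of the constraint sufficiently. -/
def LineSearchInput.ConstraintTest {n : ℕ} (L : LineSearchInput n) (P : Parameters)
    (F : Vec n → ℝ) (O : Oracle n) (S : LineSearchState) : Prop :=
  let y : Vec n := L.x + S.t • L.d
  let g : Vec n := O.ghat y
  let G : Mat n := O.Ghat L.k y
  let ρ : ℝ := damping P.CGhat G
  let Fval : ℝ := F y + (S.tL - S.t) * inner ℝ g L.d
    + 1 / 2 * ρ * (S.tL - S.t) ^ 2 * G.quad L.d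
  let β : ℝ := max |F (L.x + S.tL • L.d) - Fval|
    (P.γ₂ * |S.tL - S.t| ^ P.ω₂ * ‖L.d‖ ^ P.ω₂)
  P.mF * (-(1 / 2) * (O.Gbarhat L.k y).quad L.d)
      ≤ F (L.x + S.tL • L.d) - β + inner ℝ L.d (g + (ρ * (S.tL - S.t)) • G.app L.d) ∧
    (S.t - S.tL) * ‖L.d‖ ≤ P.CS

/-- Step 2 of the line search: the decision whether to return with a short or null step. -/
def LineSearchInput.Accepts {n : ℕ} (L : LineSearchInput n) (P : Parameters)
    (f F : Vec n → ℝ) (O : Oracle n) (S : LineSearchState) : Prop :=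
  (L.iN < P.il ∧ F (L.x + S.t • L.d) < 0 ∧ L.ObjectiveTest P f O S) ∨
  (L.iN < P.il ∧ 0 ≤ F (L.x + S.t • L.d) ∧ L.ConstraintTest P F O S) ∨
  (P.il ≤ L.iN ∧ F (L.x + S.t • L.d) < 0 ∧ L.ObjectiveTest P f O S)

/-- The states of the line search at the beginning of step 1: the initial state, and every state
that arises by one pass through the loop that does not return. -/
inductive LineSearchInput.Reaches {n : ℕ} (L : LineSearchInput n) (P : Parameters)
    (f F : Vec n → ℝ) (O : Oracle n) : LineSearchState → Prop
  | start : LineSearchInput.Reaches L P f F O { tL := 0, tU := 1, t₀ := P.t₀, t := 1 }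
  | loop (S S' : LineSearchState) (t : ℝ)
      (hS : LineSearchInput.Reaches L P f F O S)
      (hS' : S' = L.modify P f F S)
      (not_serious : S'.tL < S'.t₀)
      (not_accepted : ¬ L.Accepts P f F O S')
      (interpolation : t ∈ Set.Icc (S'.tL + P.ζ * (S'.tU - S'.tL) ^ P.ϑ)
        (S'.tU - P.ζ * (S'.tU - S'.tL) ^ P.ϑ)) :
      LineSearchInput.Reaches L P f F O { S' with t := t }

/-- The line search terminates and returns `tL`, `tR`, `t₀`. -/
def LineSearchInput.Returns {n : ℕ} (L : LineSearchInput n) (P : Parameters)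
    (f F : Vec n → ℝ) (O : Oracle n) (tL tR t₀ : ℝ) : Prop :=
  ∃ S S' : LineSearchState, L.Reaches P f F O S ∧ S' = L.modify P f F S ∧
    tL = S'.tL ∧ t₀ = S'.t₀ ∧
    ((S'.t₀ ≤ S'.tL ∧ tR = S'.tL) ∨
      (S'.tL < S'.t₀ ∧ L.Accepts P f F O S' ∧ tR = S'.t))

/-! ### The data of a run of the algorithm

Iterations are counted from `1`; values at index `0` have no meaning. The iteration index `k`
(upper index) comes first, the bundle index `j` (lower index) second. -/

/-- The data of a run that belongs to one of the two functions `f` and `F`, in the notation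
for `f`. -/
structure FunctionModel (n : ℕ) where
  /-- `g_j` -/
  sub : ℕ → Vec n
  /-- `G_j` -/
  hess : ℕ → Mat n
  /-- `ρ_j` -/
  damp : ℕ → ℝ
  /-- `f_j^k` -/
  val : ℕ → ℕ → ℝ
  /-- `g_j^k` -/
  grad : ℕ → ℕ → Vec n
  /-- `f_p^k` -/
  valP : ℕ → ℝ
  /-- `g_p^k` -/
  gradP : ℕ → Vec n
  /-- `G_p^k` -/
  hessP : ℕ → Mat n
  /-- `s_p^k` -/
  locP : ℕ → ℝ
  /-- the positive definite matrices for the bundle elements, for `j ∈ J_k` -/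
  bar : ℕ → ℕ → Mat n
  /-- the positive definite matrix for the aggregate -/
  barP : ℕ → Mat n

/-- All sequences of a run. -/
structure Iterates (n : ℕ) where
  /-- iteration points `x_k` and trial points `y_k` -/
  x : ℕ → Vec n
  y : ℕ → Vec n
  /-- bundle index sets `J_k` -/
  J : ℕ → Finset ℕ
  /-- number of subsequent null and short steps, at the beginning of iteration `k` -/
  iN : ℕ → ℕ
  /-- number of serious steps since the last bundle reset, at the beginning of iteration `k` -/
  iS : ℕ → ℕ
  /-- locality measures `s_j^k` -/
  s : ℕ → ℕ → ℝ
  /-- the data of the objective and of the constraint -/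
  obj : FunctionModel n
  con : FunctionModel n
  /-- the positive definite matrices of the objective of the search direction problem -/
  Wbar : ℕ → Mat n
  /-- the solution `(d_k, v̂_k)` of the search direction problem -/
  d : ℕ → Vec n
  vhat : ℕ → ℝ
  /-- its Lagrange multipliers `λ_j^k`, `λ_p^k`, `μ_j^k`, `μ_p^k` -/
  lam : ℕ → ℕ → ℝ
  lamP : ℕ → ℝ
  mu : ℕ → ℕ → ℝ
  muP : ℕ → ℝ
  /-- the multiplier `κ̄^k` -/
  kbar : ℕ → ℝ
  /-- the step sizes `t_L^k`, `t_R^k`, `t_0^k` -/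
  tL : ℕ → ℝ
  tR : ℕ → ℝ
  t₀ : ℕ → ℝ

/-- `∑_{j ∈ J} c_j v_j + c_p v_p`. -/
def aggregate {V : Type*} [AddCommMonoid V] [Module ℝ V] (J : Finset ℕ) (c : ℕ → ℝ) (cP : ℝ)
    (v : ℕ → V) (vP : V) : V :=
  ∑ j ∈ J, c j • v j + cP • vP

namespace Iterates

variable {n : ℕ} (I : Iterates n)

/-- `κ_j^k` (recall that `κ̄^{k+1}` is computed at iteration `k`). -/
noncomputable def kap (k j : ℕ) : ℝ := if 0 < I.kbar (k + 1) then I.mu k j / I.kbar (k + 1) else 0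

/-- `κ_p^k` -/
noncomputable def kapP (k : ℕ) : ℝ := if 0 < I.kbar (k + 1) then I.muP k / I.kbar (k + 1) else 0

/-- The aggregated data `g̃_p^k`, `f̃_p^k`, `s̃_p^k` of the objective and `∑ λ_j^k ρ_j G_j + λ_p^k G_p^k`
(which is to become `G_p^{k+1}`). -/
noncomputable def objGrad (k : ℕ) : Vec n :=
  aggregate (I.J k) (I.lam k) (I.lamP k) (I.obj.grad k) (I.obj.gradP k)
noncomputable def objVal (k : ℕ) : ℝ :=
  aggregate (I.J k) (I.lam k) (I.lamP k) (I.obj.val k) (I.obj.valP k)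
noncomputable def objLoc (k : ℕ) : ℝ :=
  aggregate (I.J k) (I.lam k) (I.lamP k) (I.s k) (I.obj.locP k)
noncomputable def objHess (k : ℕ) : Mat n :=
  aggregate (I.J k) (I.lam k) (I.lamP k) (fun j => I.obj.damp j • I.obj.hess j) (I.obj.hessP k)

/-- The corresponding aggregated data of the constraint. -/
noncomputable def conGrad (k : ℕ) : Vec n :=
  aggregate (I.J k) (I.kap k) (I.kapP k) (I.con.grad k) (I.con.gradP k)
noncomputable def conVal (k : ℕ) : ℝ :=
  aggregate (I.J k) (I.kap k) (I.kapP k) (I.con.val k) (I.con.valP k)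
noncomputable def conLoc (k : ℕ) : ℝ :=
  aggregate (I.J k) (I.kap k) (I.kapP k) (I.s k) (I.con.locP k)
noncomputable def conHess (k : ℕ) : Mat n :=
  aggregate (I.J k) (I.kap k) (I.kapP k) (fun j => I.con.damp j • I.con.hess j) (I.con.hessP k)

/-- The localized approximation errors `α_j^k`, `α_p^k`, `A_j^k`, `A_p^k`. -/
noncomputable def alpha (P : Parameters) (f : Vec n → ℝ) (k j : ℕ) : ℝ :=
  locError P.γ₁ P.ω₁ (f (I.x k) - I.obj.val k j) (I.s k j)
noncomputable def alphaP (P : Parameters) (f : Vec n → ℝ) (k : ℕ) : ℝ :=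
  locError P.γ₁ P.ω₁ (f (I.x k) - I.obj.valP k) (I.obj.locP k)
noncomputable def bigA (P : Parameters) (F : Vec n → ℝ) (k j : ℕ) : ℝ :=
  locError P.γ₂ P.ω₂ (F (I.x k) - I.con.val k j) (I.s k j)
noncomputable def bigAP (P : Parameters) (F : Vec n → ℝ) (k : ℕ) : ℝ :=
  locError P.γ₂ P.ω₂ (F (I.x k) - I.con.valP k) (I.con.locP k)

/-- The aggregated errors `α̃_p^k` and `Ã_p^k`. -/
noncomputable def alphaTilde (P : Parameters) (f : Vec n → ℝ) (k : ℕ) : ℝ :=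
  locError P.γ₁ P.ω₁ (f (I.x k) - I.objVal k) (I.objLoc k)
noncomputable def bigATilde (P : Parameters) (F : Vec n → ℝ) (k : ℕ) : ℝ :=
  locError P.γ₂ P.ω₂ (F (I.x k) - I.conVal k) (I.conLoc k)

/-- The part `∑ λ_j^k Ḡ_j^k + λ_p^k Ḡ^k + ∑ μ_j^k Ḡ̂_j^k + μ_p^k Ḡ̂^k` of the Hessian of the
Lagrangian of the search direction problem. -/
noncomputable def constraintHess (k : ℕ) : Mat n :=
  aggregate (I.J k) (I.lam k) (I.lamP k) (I.obj.bar k) (I.obj.barP k) +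
    aggregate (I.J k) (I.mu k) (I.muP k) (I.con.bar k) (I.con.barP k)

/-- `H_k = (W̄_p^k + ∑ λ_j^k Ḡ_j^k + λ_p^k Ḡ^k + ∑ μ_j^k Ḡ̂_j^k + μ_p^k Ḡ̂^k)^(-1/2)` -/
noncomputable def H (k : ℕ) : Mat n := (I.Wbar k + I.constraintHess k).invSqrt

/-- The predicted descent `v_k`. -/
noncomputable def v (P : Parameters) (f F : Vec n → ℝ) (k : ℕ) : ℝ :=
  -(I.Wbar k).quad (I.d k) - 1 / 2 * (I.constraintHess k).quad (I.d k)
    - I.alphaTilde P f k - I.kbar (k + 1) * I.bigATilde P F k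
    - I.kbar (k + 1) * (-F (I.x k))

/-- The termination quantity `w_k`. -/
noncomputable def w (P : Parameters) (f F : Vec n → ℝ) (k : ℕ) : ℝ :=
  1 / 2 * ‖(I.H k).app (I.objGrad k + I.kbar (k + 1) • I.conGrad k)‖ ^ 2
    + I.alphaTilde P f k + I.kbar (k + 1) * I.bigATilde P F k
    + I.kbar (k + 1) * (-F (I.x k))

/-- Step `k` is a serious step. -/
def Serious (k : ℕ) : Prop := I.t₀ k ≤ I.tL k

open Classical in
/-- The matrix `W` at iteration `k`. -/
noncomputable def W (P : Parameters) (k : ℕ) : Mat n :=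
  if 3 ≤ k ∧ I.Serious (k - 1) ∧ I.Serious (k - 2) ∧
      (I.lam (k - 1) (k - 1) = 1 ∨ P.ir < I.iS k) then
    I.obj.hess k + I.kbar k • I.con.hess k
  else I.obj.hessP k + I.kbar k • I.con.hessP k

/-- The left hand sides `c ≤ 0` of the four groups of constraints of the search direction problem
at `(d, v̂)`. -/
noncomputable def objCon (P : Parameters) (f : Vec n → ℝ) (k : ℕ) (d : Vec n) (vh : ℝ)
    (j : ℕ) : ℝ :=
  -I.alpha P f k j + inner ℝ d (I.obj.grad k j) + 1 / 2 * (I.obj.bar k j).quad d - vh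
noncomputable def objConP (P : Parameters) (f : Vec n → ℝ) (k : ℕ) (d : Vec n) (vh : ℝ) : ℝ :=
  -I.alphaP P f k + inner ℝ d (I.obj.gradP k) + 1 / 2 * (I.obj.barP k).quad d - vh
noncomputable def conCon (P : Parameters) (F : Vec n → ℝ) (k : ℕ) (d : Vec n) (j : ℕ) : ℝ :=
  F (I.x k) - I.bigA P F k j + inner ℝ d (I.con.grad k j) + 1 / 2 * (I.con.bar k j).quad d
noncomputable def conConP (P : Parameters) (F : Vec n → ℝ) (k : ℕ) (d : Vec n) : ℝ :=
  F (I.x k) - I.bigAP P F k + inner ℝ d (I.con.gradP k) + 1 / 2 * (I.con.barP k).quad d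

/-- The feasible set of the search direction problem of iteration `k`; the aggregated constraints
are present only if `iS ≤ ir`. -/
def feasible (P : Parameters) (f F : Vec n → ℝ) (k : ℕ) : Set (Vec n × ℝ) :=
  {q | (∀ j ∈ I.J k, I.objCon P f k q.1 q.2 j ≤ 0) ∧
    (I.iS k ≤ P.ir → I.objConP P f k q.1 q.2 ≤ 0) ∧
    (∀ j ∈ I.J k, I.conCon P F k q.1 j ≤ 0) ∧
    (I.iS k ≤ P.ir → I.conConP P F k q.1 ≤ 0)}

/-- `(d_k, v̂_k)` solves the search direction problem of iteration `k`. -/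
def SolvesQCQP (P : Parameters) (f F : Vec n → ℝ) (k : ℕ) : Prop :=
  (I.d k, I.vhat k) ∈ I.feasible P f F k ∧
  IsMinOn (fun q : Vec n × ℝ => q.2 + 1 / 2 * (I.Wbar k).quad q.1) (I.feasible P f F k)
    (I.d k, I.vhat k)

/-- `(λ^k, λ_p^k, μ^k, μ_p^k)` is a Lagrange multiplier for the solution `(d_k, v̂_k)`
(Karush-Kuhn-Tucker conditions); multipliers of absent constraints are zero. -/
structure IsMultiplier (P : Parameters) (f F : Vec n → ℝ) (k : ℕ) : Prop where
  lam_nonneg : ∀ j, 0 ≤ I.lam k j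
  lamP_nonneg : 0 ≤ I.lamP k
  mu_nonneg : ∀ j, 0 ≤ I.mu k j
  muP_nonneg : 0 ≤ I.muP k
  lam_absent : ∀ j, j ∉ I.J k → I.lam k j = 0
  mu_absent : ∀ j, j ∉ I.J k → I.mu k j = 0
  lamP_absent : P.ir < I.iS k → I.lamP k = 0
  muP_absent : P.ir < I.iS k → I.muP k = 0
  /-- derivative of the Lagrangian with respect to `v̂` -/
  stationary_v : ∑ j ∈ I.J k, I.lam k j + I.lamP k = 1
  /-- derivative of the Lagrangian with respect to `d` -/
  stationary_d : (I.Wbar k + I.constraintHess k).app (I.d k)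
    + aggregate (I.J k) (I.lam k) (I.lamP k) (I.obj.grad k) (I.obj.gradP k)
    + aggregate (I.J k) (I.mu k) (I.muP k) (I.con.grad k) (I.con.gradP k) = 0
  /-- complementary slackness -/
  slack_obj : ∀ j ∈ I.J k, I.lam k j * I.objCon P f k (I.d k) (I.vhat k) j = 0
  slack_objP : I.lamP k * I.objConP P f k (I.d k) (I.vhat k) = 0
  slack_con : ∀ j ∈ I.J k, I.mu k j * I.conCon P F k (I.d k) j = 0
  slack_conP : I.muP k * I.conConP P F k (I.d k) = 0

/-- The input of the line search at iteration `k`. -/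
noncomputable def lineSearchInput (P : Parameters) (f F : Vec n → ℝ) (k : ℕ) :
    LineSearchInput n where
  k := k
  iN := I.iN k
  x := I.x k
  d := I.d k
  v := I.v P f F k

end Iterates

/-! ### The algorithm -/

/-- Initialization of the data of one function `h` (with subgradient `g` and matrix `G` at
`y_1`). -/
structure FunctionModel.Init {n : ℕ} (m : FunctionModel n) (h : Vec n → ℝ) (y g : Vec n)
    (G : Mat n) : Prop where
  sub : m.sub 1 = g
  hess : m.hess 1 = G
  damp : m.damp 1 = 1
  val : m.val 1 1 = h y
  grad : m.grad 1 1 = g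
  valP : m.valP 1 = h y
  gradP : m.gradP 1 = g
  hessP : m.hessP 1 = G
  locP : m.locP 1 = 0

/-- Evaluation at the trial point `y_{k+1}` and update of the data of one function `h` at the end
of iteration `k`, where `x`, `x'` are `x_k`, `x_{k+1}`, `y'` is `y_{k+1}`, `g'`, `G'`, `ρ'` are the
new subgradient, matrix and damping parameter, and `valT`, `gradT`, `hessT`, `locT` are the
aggregated data of iteration `k`. -/
structure FunctionModel.Update {n : ℕ} (m : FunctionModel n) (k : ℕ) (h : Vec n → ℝ)
    (x x' y' g' : Vec n) (G' : Mat n) (ρ' : ℝ) (valT : ℝ) (gradT : Vec n) (hessT : Mat n)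
    (locT : ℝ) : Prop where
  sub : m.sub (k + 1) = g'
  hess : m.hess (k + 1) = G'
  damp : m.damp (k + 1) = ρ'
  val_old : ∀ j, 1 ≤ j → j ≤ k → m.val (k + 1) j =
    m.val k j + inner ℝ (m.grad k j) (x' - x) + 1 / 2 * m.damp j * (m.hess j).quad (x' - x)
  val_new : m.val (k + 1) (k + 1) =
    h y' + inner ℝ g' (x' - y') + 1 / 2 * ρ' * G'.quad (x' - y')
  grad_old : ∀ j, 1 ≤ j → j ≤ k → m.grad (k + 1) j =
    m.grad k j + m.damp j • (m.hess j).app (x' - x)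
  grad_new : m.grad (k + 1) (k + 1) = g' + ρ' • G'.app (x' - y')
  hessP : m.hessP (k + 1) = hessT
  valP : m.valP (k + 1) = valT + inner ℝ gradT (x' - x) + 1 / 2 * hessT.quad (x' - x)
  gradP : m.gradP (k + 1) = gradT + hessT.app (x' - x)
  locP : m.locP (k + 1) = locT + ‖x' - x‖

/-- Step 1 at iteration `k`: determination of the positive definite matrices `Ḡ_j^k`, `Ḡ^k` of one
function, with norm bound `C`. -/
structure FunctionModel.MatrixChoice {n : ℕ} (m : FunctionModel n) (P : Parameters) (C : ℝ)
    (iN k : ℕ) (J : Finset ℕ) : Prop where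
  modifyP : iN ≤ P.im + P.il → IsPosDefModification (m.hessP k) (m.barP k)
  modify : iN < P.im + P.il → ∀ j ∈ J, IsPosDefModification (m.hess j) (m.bar k j)
  keepP : P.im + P.il < iN → m.barP k = m.barP (k - 1)
  same : P.im + P.il ≤ iN → ∀ j ∈ J, m.bar k j = m.barP k
  boundP : (m.barP k).specNorm ≤ C
  bound : ∀ j ∈ J, (m.bar k j).specNorm ≤ C

/-- `I` consists of the sequences that an infinite run of the algorithm for `min f(x)` s.t.
`F(x) ≤ 0` generates, i.e. a run in which every iteration `k = 1, 2, …` is carried out. (That the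
termination criterion never applies is not part of this definition.) -/
structure Iterates.IsRun {n : ℕ} (I : Iterates n) (P : Parameters) (f F : Vec n → ℝ)
    (O : Oracle n) : Prop where
  /- initialization -/
  init_feasible : F (I.x 1) < 0
  init_y : I.y 1 = I.x 1
  init_J : I.J 1 = {1}
  init_iN : I.iN 1 = 0
  init_iS : I.iS 1 = 0
  init_s : I.s 1 1 = 0
  init_kbar : I.kbar 1 = 1
  init_obj : I.obj.Init f (I.y 1) (O.g (I.y 1)) (O.G 0 (I.y 1))
  init_con : I.con.Init F (I.y 1) (O.ghat (I.y 1)) (O.Ghat 0 (I.y 1))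
  /- determination of the matrices for the search direction problem -/
  Wbar_modify : ∀ k, 1 ≤ k → I.iN k ≤ P.im + P.il → IsPosDefModification (I.W P k) (I.Wbar k)
  Wbar_keep : ∀ k, 1 ≤ k → P.im + P.il < I.iN k → I.Wbar k = I.Wbar (k - 1)
  obj_matrices : ∀ k, 1 ≤ k → I.obj.MatrixChoice P P.CGbar (I.iN k) k (I.J k)
  con_matrices : ∀ k, 1 ≤ k → I.con.MatrixChoice P P.CGbarhat (I.iN k) k (I.J k)
  /- search direction -/
  solves : ∀ k, 1 ≤ k → I.SolvesQCQP P f F k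
  multiplier : ∀ k, 1 ≤ k → I.IsMultiplier P f F k
  kbar_succ : ∀ k, 1 ≤ k → I.kbar (k + 1) = ∑ j ∈ I.J k, I.mu k j + I.muP k
  /- line search and new points -/
  line_search : ∀ k, 1 ≤ k →
    (I.lineSearchInput P f F k).Returns P f F O (I.tL k) (I.tR k) (I.t₀ k)
  x_succ : ∀ k, 1 ≤ k → I.x (k + 1) = I.x k + I.tL k • I.d k
  y_succ : ∀ k, 1 ≤ k → I.y (k + 1) = I.x k + I.tR k • I.d k
  /- counters: `iN`, and `iS`, which is reset to `0` if `iS > ir` -/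
  iN_serious : ∀ k, 1 ≤ k → I.Serious k → I.iN (k + 1) = 0
  iN_other : ∀ k, 1 ≤ k → ¬ I.Serious k → I.iN (k + 1) = I.iN k + 1
  iS_serious : ∀ k, 1 ≤ k → I.Serious k →
    I.iS (k + 1) = (if P.ir < I.iS k then 0 else I.iS k) + 1
  iS_other : ∀ k, 1 ≤ k → ¬ I.Serious k →
    I.iS (k + 1) = if P.ir < I.iS k then 0 else I.iS k
  /- updates -/
  s_old : ∀ k, 1 ≤ k → ∀ j, 1 ≤ j → j ≤ k → I.s (k + 1) j = I.s k j + ‖I.x (k + 1) - I.x k‖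
  s_new : ∀ k, 1 ≤ k → I.s (k + 1) (k + 1) = ‖I.x (k + 1) - I.y (k + 1)‖
  obj_update : ∀ k, 1 ≤ k → I.obj.Update k f (I.x k) (I.x (k + 1)) (I.y (k + 1))
    (O.g (I.y (k + 1))) (O.G k (I.y (k + 1)))
    (objDamping P (I.iN k) (O.G k (I.y (k + 1))))
    (I.objVal k) (I.objGrad k) (I.objHess k) (I.objLoc k)
  con_update : ∀ k, 1 ≤ k → I.con.Update k F (I.x k) (I.x (k + 1)) (I.y (k + 1))
    (O.ghat (I.y (k + 1))) (O.Ghat k (I.y (k + 1)))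
    (damping P.CGhat (O.Ghat k (I.y (k + 1))))
    (I.conVal k) (I.conGrad k) (I.conHess k) (I.conLoc k)
  J_succ : ∀ k, 1 ≤ k → ∀ j ∈ I.J (k + 1), 1 ≤ j ∧ k + 2 ≤ j + P.M ∧ j ≤ k + 1
  mem_J_succ : ∀ k, 1 ≤ k → k + 1 ∈ I.J (k + 1)

/-- `σ(z) = liminf_{k → ∞} max (w_k, |x_k - z|)`, as an extended real number. -/
noncomputable def Iterates.sigma {n : ℕ} (I : Iterates n) (P : Parameters) (f F : Vec n → ℝ)
    (z : Vec n) : EReal :=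
  liminf (fun k : ℕ => ((max (I.w P f F k) ‖I.x k - z‖ : ℝ) : EReal)) atTop

/-! ### Clarke subdifferential of a locally Lipschitz function -/

section Clarke

variable {n : ℕ} {f : Vec n → ℝ}

/-! Feasibility of the iterates makes `w_k` a sum of nonnegative terms. Since `σ(x̄) = 0`, there is
an ultrafilter `U` finer than `atTop` along which `w_k → 0` and `x_k → x̄`, so every summand tends
to zero along `U`. Bounded sequences converge along `U`, so no subsequences have to be extracted.

Gradient of the Lagrangian. A lower bound for `W̄^(-1/2)` is an upper bound for `W̄`, and the rest
of the Hessian is bounded because the multipliers are. Thus `H_k` cannot shrink vectors arbitrarily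
(`exists_norm_sq_le`), and the aggregated gradients `g̃_k + κ̄ ĝ̃_k` tend to zero. Each of the two
is bounded (`norm_aggregate_grad_le`), so they have limits `g` and `gh` with `g + κ gh = 0`.

Limits as subgradients. If `a > f⁰(x̄, u)`, then on a bounded set all subgradients at `y` satisfy
`⟨g, u⟩ ≤ a + K |y - x̄|` (`exists_inner_subgradient_le`). This bound is affine in the distance, so
it survives repeated aggregation, with the aggregated locality measure in place of the distance
(`inner_aggregate_grad_le`). The errors in `w_k` dominate a power of that measure. Hence it tends to
zero for `f`, and also for `F` when `κ > 0`. The limit `k → U` followed by `a ↓ f⁰(x̄, u)` gives the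
Clarke inequality (`inner_lim_le`).

Weights. The coefficients `κ_j, κ_p` vanish altogether when `κ̄^{k+1} = 0`, so a constraint
aggregate may be only a subconvex combination, and later aggregates inherit the deficit. Its total
weight has a limit `θ ∈ [0, 1]`, and the result is `⟨gh, u⟩ ≤ θ F⁰(x̄, u)`. The multiplier sought is
therefore `κ θ`, or `0` in the degenerate cases (`exists_isStationaryWith`). -/

theorem inner_le_clarkeDeriv {x g : Vec n} (hg : g ∈ subdifferential f x) (d : Vec n) :
    inner ℝ g d ≤ clarkeDeriv f x d := by
  -- For fixed `d` the inequality describes a half-space, so it passes from the generating set to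
  -- its convex hull.
  refine convexHull_min (t := {g : Vec n | inner ℝ g d ≤ clarkeDeriv f x d})
    (fun g (h : ∀ d, inner ℝ g d ≤ clarkeDeriv f x d) => h d) ?_ hg
  refine convex_halfSpace_le (f := fun g : Vec n => inner ℝ g d) ⟨fun a b => ?_, fun c a => ?_⟩ _
  · exact inner_add_left a b d
  · simp [inner_smul_left]

theorem mem_subdifferential {x g : Vec n} (hg : ∀ d, inner ℝ g d ≤ clarkeDeriv f x d) :
    g ∈ subdifferential f x :=
  subset_convexHull ℝ _ hg

theorem tendsto_clarke_base (x : Vec n) (d : Vec n) :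
    Tendsto (fun p : Vec n × ℝ => x + p.1 + p.2 • d) (𝓝 (0 : Vec n) ×ˢ 𝓝[>] (0 : ℝ)) (𝓝 x) := by
  have h : Tendsto (fun p : Vec n × ℝ => x + p.1 + p.2 • d) (𝓝 ((0 : Vec n), (0 : ℝ))) (𝓝 x) := by
    have : Continuous (fun p : Vec n × ℝ => x + p.1 + p.2 • d) := by fun_prop
    simpa using this.tendsto ((0 : Vec n), (0 : ℝ))
  rw [nhds_prod_eq] at h
  exact h.mono_left (prod_mono le_rfl nhdsWithin_le_nhds)

/-- Near every point the difference quotients in the Clarke derivative are bounded by a Lipschitz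
constant. -/
theorem eventually_abs_quotient_le (hf : LocallyLipschitz f) (x : Vec n) :
    ∃ L : ℝ, 0 ≤ L ∧ ∀ᶠ y in 𝓝 x, ∀ d : Vec n, ∀ᶠ p : Vec n × ℝ in 𝓝 (0 : Vec n) ×ˢ 𝓝[>] (0 : ℝ),
      |(f (y + p.1 + p.2 • d) - f (y + p.1)) / p.2| ≤ L * ‖d‖ := by
  obtain ⟨K, t, ht, hK⟩ := hf x
  refine ⟨K, K.2, ?_⟩
  filter_upwards [eventually_mem_nhds_iff.2 ht] with y hy d
  have h1 := (tendsto_clarke_base y d).eventually hy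
  have h2 := (tendsto_clarke_base y 0).eventually hy
  have h3 : ∀ᶠ p : Vec n × ℝ in 𝓝 (0 : Vec n) ×ˢ 𝓝[>] (0 : ℝ), 0 < p.2 :=
    tendsto_snd.eventually self_mem_nhdsWithin
  filter_upwards [h1, h2, h3] with p hp1 hp2 hp3
  have h := hK.dist_le_mul _ hp1 _ hp2
  rw [abs_div, abs_of_pos hp3, div_le_iff₀ hp3]
  simpa [dist_eq_norm, norm_smul, abs_of_pos hp3, mul_assoc, mul_comm, mul_left_comm] using h

/-- The real-valued `limsup` obeys an eventual upper bound once the quotients are also bounded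
below, which the local Lipschitz constant ensures. -/
theorem clarkeDeriv_le_of_eventually (hf : LocallyLipschitz f) (x d : Vec n) {a : ℝ}
    (h : ∀ᶠ p : Vec n × ℝ in 𝓝 (0 : Vec n) ×ˢ 𝓝[>] (0 : ℝ),
      (f (x + p.1 + p.2 • d) - f (x + p.1)) / p.2 ≤ a) :
    clarkeDeriv f x d ≤ a := by
  obtain ⟨L, -, hL⟩ := eventually_abs_quotient_le hf x
  have hb : IsBoundedUnder (· ≥ ·) (𝓝 (0 : Vec n) ×ˢ 𝓝[>] (0 : ℝ))
      (fun p : Vec n × ℝ => (f (x + p.1 + p.2 • d) - f (x + p.1)) / p.2) :=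
    ⟨-(L * ‖d‖), by
      rw [eventually_map]
      filter_upwards [hL.self_of_nhds d] with p hp using (abs_le.1 hp).1⟩
  exact limsup_le_of_le hb.isCoboundedUnder_le h

/-- The Clarke derivative is upper semicontinuous in the base point. -/
theorem eventually_clarkeDeriv_le (hf : LocallyLipschitz f) (x d : Vec n) {a : ℝ}
    (ha : clarkeDeriv f x d < a) : ∀ᶠ y in 𝓝 x, clarkeDeriv f y d ≤ a := by
  obtain ⟨L, -, hL⟩ := eventually_abs_quotient_le hf x
  have hb : IsBoundedUnder (· ≤ ·) (𝓝 (0 : Vec n) ×ˢ 𝓝[>] (0 : ℝ))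
      (fun p : Vec n × ℝ => (f (x + p.1 + p.2 • d) - f (x + p.1)) / p.2) :=
    ⟨L * ‖d‖, by
      rw [eventually_map]
      filter_upwards [hL.self_of_nhds d] with p hp using (abs_le.1 hp).2⟩
  have h := eventually_lt_of_limsup_lt ha hb
  obtain ⟨pa, hpa, pb, hpb, hp⟩ := eventually_prod_iff.1 h
  have hsub : Tendsto (fun y : Vec n => y - x) (𝓝 x) (𝓝 0) := by
    simpa using (continuous_sub_right x).tendsto x
  -- The quotients based at `y` with offset `h` are those based at `x` with offset `y - x + h`; a
  -- property that holds near offset `0` also holds near every sufficiently small `y - x`.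
  filter_upwards [(hsub.eventually (eventually_eventually_nhds.2 hpa))] with y hy
  refine clarkeDeriv_le_of_eventually hf y d ?_
  have hadd : Tendsto (fun z : Vec n => y - x + z) (𝓝 0) (𝓝 (y - x)) := by
    simpa using (continuous_const_add (y - x)).tendsto 0
  filter_upwards [(hadd.eventually hy).prod_mk hpb] with p hq
  have := (hp hq.1 hq.2).le
  simpa [← add_assoc] using this

/-- Subgradients are bounded on compact sets. -/
theorem exists_subgradient_bound (hf : LocallyLipschitz f) {S : Set (Vec n)} (hS : IsCompact S) :
    ∃ L : ℝ, 0 ≤ L ∧ ∀ y ∈ S, ∀ g ∈ subdifferential f y, ‖g‖ ≤ L := by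
  refine hS.induction_on (p := fun S => ∃ L : ℝ, 0 ≤ L ∧ ∀ y ∈ S, ∀ g ∈ subdifferential f y, ‖g‖ ≤ L)
    ⟨0, le_rfl, by simp⟩ ?_ ?_ ?_
  · rintro s t hst ⟨L, h0, hL⟩
    exact ⟨L, h0, fun y hy => hL y (hst hy)⟩
  · rintro s t ⟨L, h0, hL⟩ ⟨L', h0', hL'⟩
    refine ⟨max L L', le_max_of_le_left h0, ?_⟩
    rintro y (hy | hy) g hg
    · exact (hL y hy g hg).trans (le_max_left _ _)
    · exact (hL' y hy g hg).trans (le_max_right _ _)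
  · intro x _
    obtain ⟨L, h0, hL⟩ := eventually_abs_quotient_le hf x
    refine ⟨_, mem_nhdsWithin_of_mem_nhds hL, L, h0, fun y hy g hg => ?_⟩
    -- Testing with the direction `d = g` gives `‖g‖² ≤ f⁰(y, g) ≤ L ‖g‖`.
    have h1 : clarkeDeriv f y g ≤ L * ‖g‖ := by
      refine clarkeDeriv_le_of_eventually hf y g ?_
      filter_upwards [hy g] with p hp using (abs_le.1 hp).2
    have h2 := (inner_le_clarkeDeriv hg g).trans h1
    rw [real_inner_self_eq_norm_mul_norm] at h2
    rcases (norm_nonneg g).eq_or_lt with h | h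
    · rw [← h]; exact h0
    · exact le_of_mul_le_mul_right h2 h

/-- On bounded sets, subgradients satisfy the limiting subgradient inequality up to a term that is
linear in the distance. -/
theorem exists_inner_subgradient_le (hf : LocallyLipschitz f) {S : Set (Vec n)} (hS : IsCompact S)
    (x d : Vec n) {a : ℝ} (ha : clarkeDeriv f x d < a) :
    ∃ K : ℝ, 0 ≤ K ∧ ∀ y ∈ S, ∀ g ∈ subdifferential f y, inner ℝ g d ≤ a + K * ‖y - x‖ := by
  obtain ⟨L, h0, hL⟩ := exists_subgradient_bound hf hS
  obtain ⟨r, hr, hball⟩ := Metric.eventually_nhds_iff.1 (eventually_clarkeDeriv_le hf x d ha)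
  -- Within distance `r` semicontinuity gives the bound `a` itself; beyond it, this slope makes the
  -- linear term at least `L ‖d‖ + |a|`, which beats the crude bound `L ‖d‖`.
  refine ⟨(L * ‖d‖ + |a|) / r, by positivity, fun y hy g hg => ?_⟩
  rcases lt_or_ge (dist y x) r with h | h
  · have := (inner_le_clarkeDeriv hg d).trans (hball h)
    have : 0 ≤ (L * ‖d‖ + |a|) / r * ‖y - x‖ := by positivity
    linarith
  · rw [dist_eq_norm] at h
    have h1 : inner ℝ g d ≤ L * ‖d‖ :=
      (real_inner_le_norm g d).trans (mul_le_mul_of_nonneg_right (hL y hy g hg) (norm_nonneg d))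
    have h2 : L * ‖d‖ + |a| ≤ (L * ‖d‖ + |a|) / r * ‖y - x‖ := by
      rw [div_mul_eq_mul_div, le_div_iff₀ hr]
      exact mul_le_mul_of_nonneg_left h (by positivity)
    linarith [neg_abs_le a]

end Clarke

/-! ### Line search -/

section LineSearch

variable {n : ℕ} {L : LineSearchInput n} {P : Parameters} {f F : Vec n → ℝ} {O : Oracle n}

/-- The bracketing and feasibility invariant of the line search. -/
structure LineSearchInput.Invariant (L : LineSearchInput n) (F : Vec n → ℝ)
    (S : LineSearchState) : Prop where
  left : S.tL ≤ S.t
  right : S.t ≤ S.tU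
  feasible : F (L.x + S.tL • L.d) < 0

theorem LineSearchInput.Invariant.modify {S : LineSearchState} (h : L.Invariant F S) :
    L.Invariant F (L.modify P f F S) := by
  obtain ⟨h1, h2, h3⟩ := h
  unfold LineSearchInput.modify
  split_ifs with ha hb
  · exact ⟨le_rfl, h2, ha⟩
  · exact ⟨h1, le_rfl, h3⟩
  · exact ⟨h1, le_rfl, h3⟩

/-- `tL` is `0` or a step size that has passed the test `F < 0`, and the interpolation margin is
nonnegative because `tL ≤ tU`, so the next `t` stays in the bracket. -/
theorem LineSearchInput.Reaches.invariant (hP : P.Valid) (hx : F L.x < 0) {S : LineSearchState}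
    (h : L.Reaches P f F O S) : L.Invariant F S := by
  induction h with
  | start => exact ⟨zero_le_one, le_rfl, by simpa using hx⟩
  | loop S S' t hS hS' _ _ ht ih =>
    have h := ih.modify (P := P) (f := f)
    rw [← hS'] at h
    have h0 : 0 ≤ P.ζ * (S'.tU - S'.tL) ^ P.ϑ :=
      mul_nonneg hP.ζ_mem.1.le (Real.rpow_nonneg (sub_nonneg.2 (h.left.trans h.right)) _)
    exact ⟨by linarith [ht.1], by linarith [ht.2], h.feasible⟩

theorem LineSearchInput.Accepts.dist_le {S : LineSearchState} (h : L.Accepts P f F O S) :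
    (S.t - S.tL) * ‖L.d‖ ≤ P.CS := by
  rcases h with ⟨_, _, h⟩ | ⟨_, _, h⟩ | ⟨_, _, h⟩
  exacts [h.2, h.2, h.2]

/-- The line search keeps strict feasibility, and the trial point stays close to the new
iterate. -/
theorem LineSearchInput.Returns.spec (hP : P.Valid) (hx : F L.x < 0) {tL tR t₀ : ℝ}
    (h : L.Returns P f F O tL tR t₀) :
    F (L.x + tL • L.d) < 0 ∧ |tL - tR| * ‖L.d‖ ≤ P.CS := by
  obtain ⟨S, S', hS, rfl, rfl, -, h⟩ := h
  have hi := (hS.invariant hP hx).modify (P := P) (f := f)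
  refine ⟨hi.feasible, ?_⟩
  rcases h with ⟨_, rfl⟩ | ⟨_, ha, rfl⟩
  · simpa using hP.CS_pos.le
  · rw [abs_sub_comm, abs_of_nonneg (sub_nonneg.2 hi.left)]
    exact ha.dist_le

end LineSearch

/-! ### Matrices -/

section Matrices

variable {n : ℕ}

theorem Mat.norm_app_le (A : Mat n) (v : Vec n) : ‖A.app v‖ ≤ A.specNorm * ‖v‖ :=
  (Matrix.toEuclideanCLM (n := Fin n) (𝕜 := ℝ) A).le_opNorm v

theorem Mat.app_mul (A B : Mat n) (v : Vec n) : Mat.app (A * B) v = A.app (B.app v) := by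
  simp [Mat.app]

theorem Mat.app_add (A B : Mat n) (v : Vec n) : Mat.app (A + B) v = A.app v + B.app v := by
  simp [Mat.app]

theorem Mat.app_one (v : Vec n) : Mat.app (1 : Mat n) v = v := by
  simp [Mat.app]

theorem Mat.quad_le (A : Mat n) (v : Vec n) : A.quad v ≤ A.specNorm * ‖v‖ ^ 2 := by
  have h := (real_inner_le_norm v (A.app v)).trans
    (mul_le_mul_of_nonneg_left (A.norm_app_le v) (norm_nonneg v))
  unfold Mat.quad
  nlinarith

theorem Mat.specNorm_add_le (A B : Mat n) : Mat.specNorm (A + B) ≤ A.specNorm + B.specNorm := by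
  simpa [Mat.specNorm] using norm_add_le (Matrix.toEuclideanCLM (n := Fin n) (𝕜 := ℝ) A)
    (Matrix.toEuclideanCLM (n := Fin n) (𝕜 := ℝ) B)

theorem Mat.specNorm_nonneg (A : Mat n) : 0 ≤ A.specNorm := norm_nonneg _

theorem Mat.specNorm_smul (c : ℝ) (A : Mat n) : Mat.specNorm (c • A) = |c| * A.specNorm := by
  simp [Mat.specNorm, norm_smul]

theorem Mat.inner_app_comm {A : Mat n} (hA : A.IsHermitian) (u v : Vec n) :
    inner ℝ (A.app u) v = inner ℝ u (A.app v) := by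
  have h : IsSelfAdjoint (Matrix.toEuclideanCLM (n := Fin n) (𝕜 := ℝ) A) := by
    have : IsSelfAdjoint A := hA
    exact this.map _
  exact h.isSymmetric u v

/-- The square root of a positive definite matrix: it is symmetric, its square is the matrix, and
its inverse is a two-sided inverse. -/
theorem Mat.sqrt_spec {A : Mat n} (hA : A.PosDef) :
    (CFC.sqrt A).IsHermitian ∧ CFC.sqrt A * CFC.sqrt A = A ∧
      CFC.sqrt A * A.invSqrt = 1 ∧ A.invSqrt * CFC.sqrt A = 1 := by
  have h0 : (0 : Mat n) ≤ A := Matrix.nonneg_iff_posSemidef.2 hA.posSemidef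
  have hs : CFC.sqrt A * CFC.sqrt A = A := CFC.sqrt_mul_sqrt_self A h0
  have hdet : IsUnit (CFC.sqrt A).det := by
    have h1 : (CFC.sqrt A).det * (CFC.sqrt A).det = A.det := by rw [← Matrix.det_mul, hs]
    have h2 : A.det ≠ 0 := hA.det_pos.ne'
    rw [← h1] at h2
    exact isUnit_iff_ne_zero.2 (left_ne_zero_of_mul h2)
  exact ⟨(Matrix.nonneg_iff_posSemidef.1 (CFC.sqrt_nonneg A)).1, hs,
    Matrix.mul_nonsing_inv _ hdet, Matrix.nonsing_inv_mul _ hdet⟩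

theorem Mat.norm_sqrt_app_sq {A : Mat n} (hA : A.PosDef) (v : Vec n) :
    ‖(CFC.sqrt A).app v‖ ^ 2 = A.quad v := by
  obtain ⟨h1, h2, -, -⟩ := Mat.sqrt_spec hA
  rw [← real_inner_self_eq_norm_sq, Mat.inner_app_comm h1, ← Mat.app_mul, h2]
  rfl

/-- A lower bound for `A^(-1/2)` is an upper bound for `A`. -/
theorem Mat.quad_le_of_invSqrt {A : Mat n} (hA : A.PosDef) {c : ℝ} (hc : 0 < c)
    (h : ∀ z : Vec n, c * ‖z‖ ^ 2 ≤ A.invSqrt.quad z) (v : Vec n) :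
    A.quad v ≤ (1 / c) ^ 2 * ‖v‖ ^ 2 := by
  obtain ⟨h1, h2, -, h4⟩ := Mat.sqrt_spec hA
  rw [← Mat.norm_sqrt_app_sq hA, ← mul_pow]
  refine pow_le_pow_left₀ (norm_nonneg _) ?_ 2
  -- With `z = A^(1/2) v` the hypothesis reads `c |z|² ≤ ⟨z, v⟩ ≤ |z| |v|`.
  have h5 := h ((CFC.sqrt A).app v)
  have h6 : A.invSqrt.quad ((CFC.sqrt A).app v) ≤ ‖(CFC.sqrt A).app v‖ * ‖v‖ := by
    unfold Mat.quad
    rw [← Mat.app_mul, h4, Mat.app_one]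
    exact real_inner_le_norm _ _
  rw [one_div_mul_eq_div, le_div_iff₀ hc]
  rcases (norm_nonneg ((CFC.sqrt A).app v)).eq_or_lt with h7 | h7
  · rw [← h7]; simp
  · nlinarith

/-- An upper bound for `A` controls a vector by its image under `A^(-1/2)`. -/
theorem Mat.norm_sq_le_of_quad_le {A : Mat n} (hA : A.PosDef) {K : ℝ}
    (h : ∀ v : Vec n, A.quad v ≤ K * ‖v‖ ^ 2) (z : Vec n) :
    ‖z‖ ^ 2 ≤ K * ‖A.invSqrt.app z‖ ^ 2 := by
  obtain ⟨-, -, h3, -⟩ := Mat.sqrt_spec hA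
  -- At `v = A^(-1/2) z` the quadratic form of `A` equals `‖z‖²`.
  have h := h (A.invSqrt.app z)
  rwa [← Mat.norm_sqrt_app_sq hA, ← Mat.app_mul, h3, Mat.app_one] at h

theorem damping_nonneg {C : ℝ} (hC : 0 < C) (A : Mat n) : 0 ≤ damping C A := by
  unfold damping
  split_ifs
  · exact zero_le_one
  · exact le_min zero_le_one (div_nonneg hC.le A.specNorm_nonneg)

theorem specNorm_damping_smul_le {C : ℝ} (hC : 0 < C) (A : Mat n) :
    (damping C A • A).specNorm ≤ C := by
  rw [Mat.specNorm_smul, abs_of_nonneg (damping_nonneg hC A)]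
  unfold damping
  split_ifs with h
  · rw [h]; simpa using hC.le
  · have h' : 0 < A.specNorm := lt_of_le_of_ne A.specNorm_nonneg (Ne.symm h)
    exact (mul_le_mul_of_nonneg_right (min_le_right _ _) h'.le).trans (div_mul_cancel₀ C h).le

theorem specNorm_objDamping_smul_le {P : Parameters} (hP : P.Valid) (i : ℕ) (A : Mat n) :
    (objDamping P i A • A).specNorm ≤ P.CG := by
  unfold objDamping
  split_ifs
  · exact specNorm_damping_smul_le hP.CG_pos A
  · rw [Mat.specNorm_smul]; simpa using hP.CG_pos.le

end Matrices

/-! ### Aggregation -/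

section Aggregate

variable {V : Type*} [AddCommMonoid V] [Module ℝ V] {J : Finset ℕ} {c : ℕ → ℝ} {cP : ℝ}

theorem map_aggregate {U : Type*} [AddCommMonoid U] [Module ℝ U] (φ : V →ₗ[ℝ] U) (J : Finset ℕ)
    (c : ℕ → ℝ) (cP : ℝ) (v : ℕ → V) (vP : V) :
    φ (aggregate J c cP v vP) = aggregate J c cP (fun j => φ (v j)) (φ vP) := by
  simp [aggregate]

theorem aggregate_add (J : Finset ℕ) (c : ℕ → ℝ) (cP : ℝ) (v w : ℕ → V) (vP wP : V) :
    aggregate J c cP (fun j => v j + w j) (vP + wP)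
      = aggregate J c cP v vP + aggregate J c cP w wP := by
  simp only [aggregate, smul_add, Finset.sum_add_distrib]
  abel

theorem aggregate_const (J : Finset ℕ) (c : ℕ → ℝ) (cP : ℝ) (v : V) :
    aggregate J c cP (fun _ => v) v = (∑ j ∈ J, c j + cP) • v := by
  simp only [aggregate, ← Finset.sum_smul, add_smul]

theorem aggregate_mono (hc : ∀ j ∈ J, 0 ≤ c j) (hcP : 0 ≤ cP) {v w : ℕ → ℝ} {vP wP : ℝ}
    (h : ∀ j ∈ J, v j ≤ w j) (hP : vP ≤ wP) : aggregate J c cP v vP ≤ aggregate J c cP w wP :=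
  add_le_add (Finset.sum_le_sum fun j hj => mul_le_mul_of_nonneg_left (h j hj) (hc j hj))
    (mul_le_mul_of_nonneg_left hP hcP)

theorem aggregate_nonneg (hc : ∀ j ∈ J, 0 ≤ c j) (hcP : 0 ≤ cP) {v : ℕ → ℝ} {vP : ℝ}
    (h : ∀ j ∈ J, 0 ≤ v j) (hP : 0 ≤ vP) : 0 ≤ aggregate J c cP v vP :=
  add_nonneg (Finset.sum_nonneg fun j hj => mul_nonneg (hc j hj) (h j hj)) (mul_nonneg hcP hP)

theorem norm_aggregate_le {E : Type*} [SeminormedAddCommGroup E] [NormedSpace ℝ E]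
    (hc : ∀ j ∈ J, 0 ≤ c j) (hcP : 0 ≤ cP) {v : ℕ → E} {vP : E} {B : ℝ}
    (h : ∀ j ∈ J, ‖v j‖ ≤ B) (hP : ‖vP‖ ≤ B) :
    ‖aggregate J c cP v vP‖ ≤ (∑ j ∈ J, c j + cP) * B := by
  have h1 : aggregate J c cP (fun _ => B) B = (∑ j ∈ J, c j + cP) * B := aggregate_const J c cP B
  rw [← h1]
  refine (norm_add_le _ _).trans (add_le_add ((norm_sum_le _ _).trans
    (Finset.sum_le_sum fun j hj => ?_)) ?_)
  · rw [norm_smul, Real.norm_of_nonneg (hc j hj)]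
    exact mul_le_mul_of_nonneg_left (h j hj) (hc j hj)
  · rw [norm_smul, Real.norm_of_nonneg hcP]
    exact mul_le_mul_of_nonneg_left hP hcP

end Aggregate

/-- The action of matrices on vectors as a linear map. -/
noncomputable def Mat.toCLM (n : ℕ) : Mat n →ₗ[ℝ] (Vec n →L[ℝ] Vec n) where
  toFun := Matrix.toEuclideanCLM (n := Fin n) (𝕜 := ℝ)
  map_add' := map_add _
  map_smul' := map_smul _

/-! ### The bundle of one function -/

/-- The evolution of the gradient part of the bundle of one function, for aggregation with
coefficients `c k j`, `cP k`. -/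
structure FunctionModel.Evolves {n : ℕ} (m : FunctionModel n) (x y : ℕ → Vec n) (J : ℕ → Finset ℕ)
    (s c : ℕ → ℕ → ℝ) (cP : ℕ → ℝ) : Prop where
  mem_J : ∀ k, 1 ≤ k → ∀ j ∈ J k, 1 ≤ j ∧ j ≤ k
  c_nonneg : ∀ k, 1 ≤ k → ∀ j ∈ J k, 0 ≤ c k j
  cP_nonneg : ∀ k, 1 ≤ k → 0 ≤ cP k
  sum_le_one : ∀ k, 1 ≤ k → ∑ j ∈ J k, c k j + cP k ≤ 1
  init_y : y 1 = x 1
  init_s : s 1 1 = 0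
  init_grad : m.grad 1 1 = m.sub 1
  init_gradP : m.gradP 1 = m.sub 1
  init_damp : m.damp 1 = 1
  init_hessP : m.hessP 1 = m.hess 1
  init_locP : m.locP 1 = 0
  s_old : ∀ k, 1 ≤ k → ∀ j, 1 ≤ j → j ≤ k → s (k + 1) j = s k j + ‖x (k + 1) - x k‖
  s_new : ∀ k, 1 ≤ k → s (k + 1) (k + 1) = ‖x (k + 1) - y (k + 1)‖
  grad_old : ∀ k, 1 ≤ k → ∀ j, 1 ≤ j → j ≤ k →
    m.grad (k + 1) j = m.grad k j + m.damp j • (m.hess j).app (x (k + 1) - x k)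
  grad_new : ∀ k, 1 ≤ k → m.grad (k + 1) (k + 1) =
    m.sub (k + 1) + m.damp (k + 1) • (m.hess (k + 1)).app (x (k + 1) - y (k + 1))
  hessP : ∀ k, 1 ≤ k → m.hessP (k + 1) =
    aggregate (J k) (c k) (cP k) (fun j => m.damp j • m.hess j) (m.hessP k)
  gradP : ∀ k, 1 ≤ k → m.gradP (k + 1) =
    aggregate (J k) (c k) (cP k) (m.grad k) (m.gradP k)
      + (m.hessP (k + 1)).app (x (k + 1) - x k)
  locP : ∀ k, 1 ≤ k → m.locP (k + 1) =
    aggregate (J k) (c k) (cP k) (s k) (m.locP k) + ‖x (k + 1) - x k‖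

namespace FunctionModel.Evolves

variable {n : ℕ} {m : FunctionModel n} {x y : ℕ → Vec n} {J : ℕ → Finset ℕ} {s c : ℕ → ℕ → ℝ}
  {cP : ℕ → ℝ}

/-- `s_j^k` is the length of the path from `y_j` to `x_j` and on through the iterates to `x_k`. -/
theorem dist_le (h : m.Evolves x y J s c cP) :
    ∀ k, 1 ≤ k → ∀ j, 1 ≤ j → j ≤ k → ‖x k - y j‖ ≤ s k j := by
  intro k hk
  induction k, hk using Nat.le_induction with
  | base =>
    intro j h1 h2
    obtain rfl : j = 1 := le_antisymm h2 h1
    rw [h.init_y, h.init_s]; simp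
  | succ k hk ih =>
    intro j h1 h2
    rcases Nat.lt_or_ge k j with hj | hj
    · obtain rfl : j = k + 1 := le_antisymm h2 hj
      exact (h.s_new k hk).ge
    · rw [h.s_old k hk j h1 hj]
      calc ‖x (k + 1) - y j‖ = ‖(x k - y j) + (x (k + 1) - x k)‖ := by congr 1; abel
        _ ≤ _ := (norm_add_le _ _).trans (by linarith [ih j h1 hj])

/-- The increments `ρ_j G_j (x_{k+1} - x_k)` telescope: `g_j^k` is the gradient at `x_k` of a
quadratic model centred at `y_j`. -/
theorem grad_eq (h : m.Evolves x y J s c cP) :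
    ∀ k, 1 ≤ k → ∀ j, 1 ≤ j → j ≤ k →
      m.grad k j = m.sub j + (m.damp j • m.hess j).app (x k - y j) := by
  intro k hk
  induction k, hk using Nat.le_induction with
  | base =>
    intro j h1 h2
    obtain rfl : j = 1 := le_antisymm h2 h1
    rw [h.init_y, h.init_grad]; simp [Mat.app]
  | succ k hk ih =>
    intro j h1 h2
    rcases Nat.lt_or_ge k j with hj | hj
    · obtain rfl : j = k + 1 := le_antisymm h2 hj
      rw [h.grad_new k hk]; simp [Mat.app]
    · rw [h.grad_old k hk j h1 hj, ih j h1 hj]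
      simp only [Mat.app, map_smul, map_sub, smul_apply]
      module

theorem loc_nonneg (h : m.Evolves x y J s c cP) {k : ℕ} (hk : 1 ≤ k) {j : ℕ} (hj : j ∈ J k) :
    0 ≤ s k j :=
  (norm_nonneg _).trans (h.dist_le k hk j (h.mem_J k hk j hj).1 (h.mem_J k hk j hj).2)

theorem locP_nonneg (h : m.Evolves x y J s c cP) : ∀ k, 1 ≤ k → 0 ≤ m.locP k := by
  intro k hk
  induction k, hk using Nat.le_induction with
  | base => exact h.init_locP.ge
  | succ k hk ih =>
    rw [h.locP k hk]
    exact add_nonneg (aggregate_nonneg (h.c_nonneg k hk) (h.cP_nonneg k hk)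
      (fun j hj => h.loc_nonneg hk hj) ih) (norm_nonneg _)

theorem aggregate_loc_nonneg (h : m.Evolves x y J s c cP) {k : ℕ} (hk : 1 ≤ k) :
    0 ≤ aggregate (J k) (c k) (cP k) (s k) (m.locP k) :=
  aggregate_nonneg (h.c_nonneg k hk) (h.cP_nonneg k hk) (fun _ hj => h.loc_nonneg hk hj)
    (h.locP_nonneg k hk)

theorem aggregate_norm_le {E : Type*} [SeminormedAddCommGroup E] [NormedSpace ℝ E]
    (h : m.Evolves x y J s c cP) {k : ℕ} (hk : 1 ≤ k) {v : ℕ → E} {vP : E} {B : ℝ}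
    (hv : ∀ j ∈ J k, ‖v j‖ ≤ B) (hP : ‖vP‖ ≤ B) :
    ‖aggregate (J k) (c k) (cP k) v vP‖ ≤ B :=
  (norm_aggregate_le (h.c_nonneg k hk) (h.cP_nonneg k hk) hv hP).trans
    (mul_le_of_le_one_left ((norm_nonneg _).trans hP) (h.sum_le_one k hk))

theorem specNorm_aggregate_le (h : m.Evolves x y J s c cP) {k : ℕ} (hk : 1 ≤ k) {A : ℕ → Mat n}
    {AP : Mat n} {B : ℝ} (hv : ∀ j ∈ J k, (A j).specNorm ≤ B) (hP : AP.specNorm ≤ B) :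
    Mat.specNorm (aggregate (J k) (c k) (cP k) A AP) ≤ B := by
  have h1 := map_aggregate (Mat.toCLM n) (J k) (c k) (cP k) A AP
  have h2 := h.aggregate_norm_le hk (v := fun j => Matrix.toEuclideanCLM (n := Fin n) (𝕜 := ℝ) (A j))
    (vP := Matrix.toEuclideanCLM (n := Fin n) (𝕜 := ℝ) AP) hv hP
  exact (congrArg norm h1).trans_le h2

/-- Each aggregated matrix is a subconvex combination of damped matrices and its predecessor, so
their common bound is inherited. -/
theorem specNorm_hessP_le (h : m.Evolves x y J s c cP) {C : ℝ}
    (hC : ∀ j, 1 ≤ j → (m.damp j • m.hess j).specNorm ≤ C) :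
    ∀ k, 1 ≤ k → (m.hessP k).specNorm ≤ C := by
  intro k hk
  induction k, hk using Nat.le_induction with
  | base =>
    have := hC 1 le_rfl
    rwa [h.init_damp, one_smul, ← h.init_hessP] at this
  | succ k hk ih =>
    rw [h.hessP k hk]
    exact h.specNorm_aggregate_le hk (fun j hj => hC j (h.mem_J k hk j hj).1) ih

/-- Gradients and matrices are aggregated with the same coefficients, so subtracting matrix times
`x_k` commutes with aggregation. -/
theorem aggregate_grad_sub (h : m.Evolves x y J s c cP) {k : ℕ} (hk : 1 ≤ k) :
    aggregate (J k) (c k) (cP k) (m.grad k) (m.gradP k) =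
      aggregate (J k) (c k) (cP k)
        (fun j => m.grad k j - (m.damp j • m.hess j).app (x k))
        (m.gradP k - (m.hessP k).app (x k)) + (m.hessP (k + 1)).app (x k) := by
  have h1 : (m.hessP (k + 1)).app (x k) = aggregate (J k) (c k) (cP k)
      (fun j => (m.damp j • m.hess j).app (x k)) ((m.hessP k).app (x k)) := by
    rw [h.hessP k hk]
    exact map_aggregate ((ContinuousLinearMap.apply ℝ (Vec n) (x k)).toLinearMap ∘ₗ
      Mat.toCLM n) _ _ _ _ _
  rw [h1, ← aggregate_add]
  simp

/-- The aggregated gradients are bounded. -/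
theorem norm_aggregate_grad_le (h : m.Evolves x y J s c cP) {C B R : ℝ}
    (hC : ∀ j, 1 ≤ j → (m.damp j • m.hess j).specNorm ≤ C)
    (hB : ∀ j, 1 ≤ j → ‖m.sub j‖ ≤ B) (hy : ∀ j, 1 ≤ j → ‖y j‖ ≤ R)
    (hx : ∀ k, 1 ≤ k → ‖x k‖ ≤ R) {k : ℕ} (hk : 1 ≤ k) :
    ‖aggregate (J k) (c k) (cP k) (m.grad k) (m.gradP k)‖ ≤ B + 2 * (C * R) := by
  have hC0 : 0 ≤ C := (Mat.specNorm_nonneg _).trans (hC 1 le_rfl)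
  have app_le : ∀ (A : Mat n) (v : Vec n), A.specNorm ≤ C → ‖v‖ ≤ R → ‖A.app v‖ ≤ C * R :=
    fun A v hA hv => (A.norm_app_le v).trans (mul_le_mul hA hv (norm_nonneg _) hC0)
  -- The shifted gradient `g_j^k - ρ_j G_j x_k` equals `g_j - ρ_j G_j y_j`, which does not depend on
  -- `k`.
  have hj : ∀ k, 1 ≤ k → ∀ j, 1 ≤ j → j ≤ k →
      ‖m.grad k j - (m.damp j • m.hess j).app (x k)‖ ≤ B + C * R := by
    intro k hk j h1 h2
    have h3 : m.grad k j - (m.damp j • m.hess j).app (x k)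
        = m.sub j - (m.damp j • m.hess j).app (y j) := by
      rw [h.grad_eq k hk j h1 h2]
      simp only [Mat.app, map_sub]
      abel
    rw [h3]
    exact (norm_sub_le _ _).trans (add_le_add (hB j h1) (app_le _ _ (hC j h1) (hy j h1)))
  -- Bounding `g_p^k` directly would add a term `C |x_{k+1} - x_k|` at every iteration; the shifted
  -- aggregate is merely recombined, so nothing accumulates.
  have hP : ∀ k, 1 ≤ k → ‖m.gradP k - (m.hessP k).app (x k)‖ ≤ B + C * R := by
    intro k hk
    induction k, hk using Nat.le_induction with
    | base =>
      rw [h.init_gradP, h.init_hessP]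
      exact (norm_sub_le _ _).trans (add_le_add (hB 1 le_rfl) (app_le _ _
        (by simpa [h.init_damp] using hC 1 le_rfl) (hx 1 le_rfl)))
    | succ k hk ih =>
      have h3 : m.gradP (k + 1) - (m.hessP (k + 1)).app (x (k + 1)) =
          aggregate (J k) (c k) (cP k)
            (fun j => m.grad k j - (m.damp j • m.hess j).app (x k))
            (m.gradP k - (m.hessP k).app (x k)) := by
        rw [h.gradP k hk, h.aggregate_grad_sub hk]
        simp only [Mat.app, map_sub]
        abel
      rw [h3]
      exact h.aggregate_norm_le hk
        (fun j hjk => hj k hk j (h.mem_J k hk j hjk).1 (h.mem_J k hk j hjk).2) ih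
  rw [h.aggregate_grad_sub hk]
  have h4 := h.aggregate_norm_le hk
    (fun j hjk => hj k hk j (h.mem_J k hk j hjk).1 (h.mem_J k hk j hjk).2) (hP k hk)
  have h5 := app_le _ (x k) (h.specNorm_hessP_le hC (k + 1) (by omega)) (hx k hk)
  exact (norm_add_le _ _).trans (by linarith)

end FunctionModel.Evolves

/-! ### Aggregation weights and directional bounds -/

/-- The total weight of genuine subgradients in the aggregate `g_p^k`. -/
noncomputable def aggregateWeight (J : ℕ → Finset ℕ) (c : ℕ → ℕ → ℝ) (cP : ℕ → ℝ) : ℕ → ℝ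
  | 0 => 1
  | 1 => 1
  | k + 2 => aggregate (J (k + 1)) (c (k + 1)) (cP (k + 1)) (fun _ => 1)
      (aggregateWeight J c cP (k + 1))

theorem aggregateWeight_succ (J : ℕ → Finset ℕ) (c : ℕ → ℕ → ℝ) (cP : ℕ → ℝ) {k : ℕ}
    (hk : 1 ≤ k) : aggregateWeight J c cP (k + 1) =
      aggregate (J k) (c k) (cP k) (fun _ => 1) (aggregateWeight J c cP k) := by
  obtain ⟨k, rfl⟩ := Nat.exists_eq_add_of_le' hk
  rfl

/-- This is the case of the objective, where stationarity in `v̂` forces the multipliers to sum to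
one. -/
theorem aggregateWeight_eq_one {J : ℕ → Finset ℕ} {c : ℕ → ℕ → ℝ} {cP : ℕ → ℝ}
    (h : ∀ k, 1 ≤ k → ∑ j ∈ J k, c k j + cP k = 1) :
    ∀ k, 1 ≤ k → aggregateWeight J c cP k = 1 := by
  intro k hk
  induction k, hk using Nat.le_induction with
  | base => rfl
  | succ k hk ih =>
    rw [aggregateWeight_succ J c cP hk, ih, aggregate_const, h k hk, one_smul]

namespace FunctionModel.Evolves

variable {n : ℕ} {m : FunctionModel n} {x y : ℕ → Vec n} {J : ℕ → Finset ℕ} {s c : ℕ → ℕ → ℝ}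
  {cP : ℕ → ℝ}

theorem aggregateWeight_mem (h : m.Evolves x y J s c cP) :
    ∀ k, 1 ≤ k → aggregateWeight J c cP k ∈ Set.Icc (0 : ℝ) 1 := by
  intro k hk
  induction k, hk using Nat.le_induction with
  | base => exact ⟨zero_le_one, le_rfl⟩
  | succ k hk ih =>
    rw [aggregateWeight_succ J c cP hk]
    refine ⟨aggregate_nonneg (h.c_nonneg k hk) (h.cP_nonneg k hk) (fun _ _ => zero_le_one) ih.1, ?_⟩
    refine (aggregate_mono (h.c_nonneg k hk) (h.cP_nonneg k hk) (fun _ _ => le_rfl) ih.2).trans ?_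
    rw [aggregate_const, smul_eq_mul, mul_one]
    exact h.sum_le_one k hk

/-- The aggregated gradient inherits the bound of the directional values of the subgradients,
up to a multiple of the aggregated locality measure. -/
theorem inner_aggregate_grad_le (h : m.Evolves x y J s c cP) {C a K : ℝ} (z u : Vec n)
    (hC : ∀ j, 1 ≤ j → (m.damp j • m.hess j).specNorm ≤ C) (hK : 0 ≤ K)
    (hsub : ∀ j, 1 ≤ j → inner ℝ (m.sub j) u ≤ a + K * ‖y j - z‖) {k : ℕ} (hk : 1 ≤ k) :
    inner ℝ (aggregate (J k) (c k) (cP k) (m.grad k) (m.gradP k)) u ≤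
      aggregateWeight J c cP (k + 1) * a
        + (K + C * ‖u‖) * aggregate (J k) (c k) (cP k) (s k) (m.locP k) + K * ‖x k - z‖ := by
  have hC0 : 0 ≤ C := (Mat.specNorm_nonneg _).trans (hC 1 le_rfl)
  have app_le : ∀ (A : Mat n) (v : Vec n), A.specNorm ≤ C →
      inner ℝ (A.app v) u ≤ C * ‖u‖ * ‖v‖ := by
    intro A v hA
    calc inner ℝ (A.app v) u ≤ ‖A.app v‖ * ‖u‖ := real_inner_le_norm _ _
      _ ≤ (C * ‖v‖) * ‖u‖ := by
        refine mul_le_mul_of_nonneg_right ((A.norm_app_le v).trans ?_) (norm_nonneg _)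
        exact mul_le_mul_of_nonneg_right hA (norm_nonneg _)
      _ = _ := by ring
  -- For one bundle element both the distance from `y_j` to `x_k` and the matrix correction are
  -- charged to `s_j^k`; this produces the coefficient `K + C ‖u‖`.
  have hj : ∀ k, 1 ≤ k → ∀ j, 1 ≤ j → j ≤ k →
      inner ℝ (m.grad k j) u ≤ 1 * a + (K + C * ‖u‖) * s k j + K * ‖x k - z‖ := by
    intro k hk j h1 h2
    rw [h.grad_eq k hk j h1 h2, inner_add_left]
    have h3 := app_le _ (x k - y j) (hC j h1)
    have h4 := h.dist_le k hk j h1 h2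
    have h5 : ‖y j - z‖ ≤ ‖x k - y j‖ + ‖x k - z‖ := by
      have : y j - z = -(x k - y j) + (x k - z) := by abel
      rw [this]
      exact (norm_add_le _ _).trans (by rw [norm_neg])
    have h6 := mul_le_mul_of_nonneg_left h5 hK
    have h7 := mul_le_mul_of_nonneg_left h4 (by positivity : 0 ≤ K + C * ‖u‖)
    linarith [hsub j h1]
  have step : ∀ k, 1 ≤ k → inner ℝ (m.gradP k) u ≤
      aggregateWeight J c cP k * a + (K + C * ‖u‖) * m.locP k + K * ‖x k - z‖ →
      inner ℝ (aggregate (J k) (c k) (cP k) (m.grad k) (m.gradP k)) u ≤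
      aggregateWeight J c cP (k + 1) * a
        + (K + C * ‖u‖) * aggregate (J k) (c k) (cP k) (s k) (m.locP k) + K * ‖x k - z‖ := by
    intro k hk hkP
    have h1 : inner ℝ (aggregate (J k) (c k) (cP k) (m.grad k) (m.gradP k)) u =
        aggregate (J k) (c k) (cP k) (fun j => inner ℝ (m.grad k j) u)
          (inner ℝ (m.gradP k) u) := by
      simp only [aggregate, inner_add_left, sum_inner, real_inner_smul_left, smul_eq_mul]
    rw [h1, aggregateWeight_succ J c cP hk]
    refine (aggregate_mono (h.c_nonneg k hk) (h.cP_nonneg k hk)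
      (fun j hjk => hj k hk j (h.mem_J k hk j hjk).1 (h.mem_J k hk j hjk).2) hkP).trans ?_
    rw [aggregate_add, aggregate_add, aggregate_const, smul_eq_mul]
    have h2 := map_aggregate (LinearMap.mulRight ℝ a) (J k) (c k) (cP k) (fun _ => (1 : ℝ))
      (aggregateWeight J c cP k)
    have h3 := map_aggregate (LinearMap.mulLeft ℝ (K + C * ‖u‖)) (J k) (c k) (cP k) (s k) (m.locP k)
    simp only [LinearMap.mulRight_apply, LinearMap.mulLeft_apply] at h2 h3
    rw [h2, h3]
    -- Only this nonnegative term may absorb a coefficient sum below one. The number `a` can be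
    -- negative, so its weight is kept exactly.
    have h4 : (∑ j ∈ J k, c k j + cP k) * (K * ‖x k - z‖) ≤ K * ‖x k - z‖ :=
      mul_le_of_le_one_left (by positivity) (h.sum_le_one k hk)
    linarith
  have hP : ∀ k, 1 ≤ k → inner ℝ (m.gradP k) u ≤
      aggregateWeight J c cP k * a + (K + C * ‖u‖) * m.locP k + K * ‖x k - z‖ := by
    intro k hk
    induction k, hk using Nat.le_induction with
    | base =>
      have h1 := hsub 1 le_rfl
      rw [h.init_gradP, h.init_locP, ← h.init_y]
      have h2 : aggregateWeight J c cP 1 = 1 := rfl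
      rw [h2]
      linarith
    | succ k hk ih =>
      have h1 := step k hk ih
      rw [h.gradP k hk, h.locP k hk, inner_add_left]
      -- Moving the base point from `x_k` to `x_{k+1}` costs `(K + C ‖u‖) ‖x_{k+1} - x_k‖`, exactly
      -- what the increment of the locality measure pays for.
      have h2 := app_le _ (x (k + 1) - x k) (h.specNorm_hessP_le hC (k + 1) (by omega))
      have h3 : ‖x k - z‖ ≤ ‖x (k + 1) - x k‖ + ‖x (k + 1) - z‖ := by
        have : x k - z = -(x (k + 1) - x k) + (x (k + 1) - z) := by abel
        rw [this]
        exact (norm_add_le _ _).trans (by rw [norm_neg])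
      have h4 := mul_le_mul_of_nonneg_left h3 hK
      linarith
  exact step k hk (hP k hk)

end FunctionModel.Evolves

/-! ### Properties of a run -/

namespace Iterates.IsRun

variable {n : ℕ} {f F : Vec n → ℝ} {P : Parameters} {O : Oracle n} {I : Iterates n}

theorem mem_J (h : I.IsRun P f F O) : ∀ k, 1 ≤ k → ∀ j ∈ I.J k, 1 ≤ j ∧ j ≤ k := by
  intro k hk j hj
  rcases hk.eq_or_lt with rfl | hk
  · rw [h.init_J, Finset.mem_singleton] at hj
    omega
  · obtain ⟨k, rfl⟩ := Nat.exists_eq_add_of_le' hk.le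
    have := h.J_succ k (by omega) j hj
    omega

theorem feasible_x (h : I.IsRun P f F O) (hP : P.Valid) : ∀ k, 1 ≤ k → F (I.x k) < 0 := by
  intro k hk
  induction k, hk using Nat.le_induction with
  | base => exact h.init_feasible
  | succ k hk ih =>
    rw [h.x_succ k hk]
    exact ((h.line_search k hk).spec hP ih).1

theorem norm_x_sub_y_le (h : I.IsRun P f F O) (hP : P.Valid) :
    ∀ k, 1 ≤ k → ‖I.x k - I.y k‖ ≤ P.CS := by
  intro k hk
  rcases hk.eq_or_lt with rfl | hk
  · rw [h.init_y]; simpa using hP.CS_pos.le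
  · obtain ⟨k, rfl⟩ := Nat.exists_eq_add_of_le' hk.le
    have hk' : 1 ≤ k := by omega
    have h1 := ((h.line_search k hk').spec hP (h.feasible_x hP k hk')).2
    have h2 : I.x (k + 1) - I.y (k + 1) = (I.tL k - I.tR k) • I.d k := by
      rw [h.x_succ k hk', h.y_succ k hk']; module
    rw [h2, norm_smul]
    exact h1

theorem kbar_nonneg (h : I.IsRun P f F O) {k : ℕ} (hk : 1 ≤ k) : 0 ≤ I.kbar (k + 1) := by
  rw [h.kbar_succ k hk]
  exact add_nonneg (Finset.sum_nonneg fun j _ => (h.multiplier k hk).mu_nonneg j)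
    (h.multiplier k hk).muP_nonneg

/-- The sum is `1` if `κ̄^{k+1} > 0` and `0` otherwise; the second case is why `Evolves` asks only
for an inequality. -/
theorem sum_kap_le_one (h : I.IsRun P f F O) {k : ℕ} (hk : 1 ≤ k) :
    ∑ j ∈ I.J k, I.kap k j + I.kapP k ≤ 1 := by
  unfold Iterates.kap Iterates.kapP
  split_ifs with h0
  · rw [← Finset.sum_div, ← add_div, ← h.kbar_succ k hk, div_self h0.ne']
  · simp

theorem obj_evolves (h : I.IsRun P f F O) :
    I.obj.Evolves I.x I.y I.J I.s I.lam I.lamP where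
  mem_J := h.mem_J
  c_nonneg k hk j _ := (h.multiplier k hk).lam_nonneg j
  cP_nonneg k hk := (h.multiplier k hk).lamP_nonneg
  sum_le_one k hk := (h.multiplier k hk).stationary_v.le
  init_y := h.init_y
  init_s := h.init_s
  init_grad := h.init_obj.grad.trans h.init_obj.sub.symm
  init_gradP := h.init_obj.gradP.trans h.init_obj.sub.symm
  init_damp := h.init_obj.damp
  init_hessP := h.init_obj.hessP.trans h.init_obj.hess.symm
  init_locP := h.init_obj.locP
  s_old := h.s_old
  s_new := h.s_new
  grad_old k hk := (h.obj_update k hk).grad_old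
  grad_new k hk := by
    rw [(h.obj_update k hk).sub, (h.obj_update k hk).damp, (h.obj_update k hk).hess]
    exact (h.obj_update k hk).grad_new
  hessP k hk := (h.obj_update k hk).hessP
  gradP k hk := by
    rw [(h.obj_update k hk).hessP]
    exact (h.obj_update k hk).gradP
  locP k hk := (h.obj_update k hk).locP

theorem con_evolves (h : I.IsRun P f F O) :
    I.con.Evolves I.x I.y I.J I.s I.kap I.kapP where
  mem_J := h.mem_J
  c_nonneg k hk j _ := by
    unfold Iterates.kap
    split_ifs with h0
    · exact div_nonneg ((h.multiplier k hk).mu_nonneg j) h0.le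
    · exact le_rfl
  cP_nonneg k hk := by
    unfold Iterates.kapP
    split_ifs with h0
    · exact div_nonneg (h.multiplier k hk).muP_nonneg h0.le
    · exact le_rfl
  sum_le_one k hk := h.sum_kap_le_one hk
  init_y := h.init_y
  init_s := h.init_s
  init_grad := h.init_con.grad.trans h.init_con.sub.symm
  init_gradP := h.init_con.gradP.trans h.init_con.sub.symm
  init_damp := h.init_con.damp
  init_hessP := h.init_con.hessP.trans h.init_con.hess.symm
  init_locP := h.init_con.locP
  s_old := h.s_old
  s_new := h.s_new
  grad_old k hk := (h.con_update k hk).grad_old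
  grad_new k hk := by
    rw [(h.con_update k hk).sub, (h.con_update k hk).damp, (h.con_update k hk).hess]
    exact (h.con_update k hk).grad_new
  hessP k hk := (h.con_update k hk).hessP
  gradP k hk := by
    rw [(h.con_update k hk).hessP]
    exact (h.con_update k hk).gradP
  locP k hk := (h.con_update k hk).locP

theorem obj_sub_mem (h : I.IsRun P f F O) (hO : O.Valid f F) :
    ∀ j, 1 ≤ j → I.obj.sub j ∈ subdifferential f (I.y j) := by
  intro j hj
  rcases hj.eq_or_lt with rfl | hj
  · rw [h.init_obj.sub]; exact hO.g_mem _
  · obtain ⟨k, rfl⟩ := Nat.exists_eq_add_of_le' hj.le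
    rw [(h.obj_update k (by omega)).sub]; exact hO.g_mem _

theorem con_sub_mem (h : I.IsRun P f F O) (hO : O.Valid f F) :
    ∀ j, 1 ≤ j → I.con.sub j ∈ subdifferential F (I.y j) := by
  intro j hj
  rcases hj.eq_or_lt with rfl | hj
  · rw [h.init_con.sub]; exact hO.ghat_mem _
  · obtain ⟨k, rfl⟩ := Nat.exists_eq_add_of_le' hj.le
    rw [(h.con_update k (by omega)).sub]; exact hO.ghat_mem _

theorem specNorm_obj_hess_le (h : I.IsRun P f F O) (hP : P.Valid) :
    ∃ C, ∀ j, 1 ≤ j → Mat.specNorm (I.obj.damp j • I.obj.hess j) ≤ C := by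
  -- The first matrix enters with `ρ_1 = 1`, undamped, so its own norm has to be included.
  refine ⟨max (I.obj.hess 1).specNorm P.CG, fun j hj => ?_⟩
  rcases hj.eq_or_lt with rfl | hj
  · rw [h.init_obj.damp, one_smul]; exact le_max_left _ _
  · obtain ⟨k, rfl⟩ := Nat.exists_eq_add_of_le' hj.le
    rw [(h.obj_update k (by omega)).damp, (h.obj_update k (by omega)).hess]
    exact (specNorm_objDamping_smul_le hP _ _).trans (le_max_right _ _)

theorem specNorm_con_hess_le (h : I.IsRun P f F O) (hP : P.Valid) :
    ∃ C, ∀ j, 1 ≤ j → Mat.specNorm (I.con.damp j • I.con.hess j) ≤ C := by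
  refine ⟨max (I.con.hess 1).specNorm P.CGhat, fun j hj => ?_⟩
  rcases hj.eq_or_lt with rfl | hj
  · rw [h.init_con.damp, one_smul]; exact le_max_left _ _
  · obtain ⟨k, rfl⟩ := Nat.exists_eq_add_of_le' hj.le
    rw [(h.con_update k (by omega)).damp, (h.con_update k (by omega)).hess]
    exact (specNorm_damping_smul_le hP.CGhat_pos _).trans (le_max_right _ _)

theorem posDef_Wbar (h : I.IsRun P f F O) : ∀ k, 1 ≤ k → (I.Wbar k).PosDef := by
  intro k hk
  induction k, hk using Nat.le_induction with
  | base => exact h.Wbar_modify 1 le_rfl (by rw [h.init_iN]; omega)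
  | succ k hk ih =>
    rcases le_or_gt (I.iN (k + 1)) (P.im + P.il) with h1 | h1
    · exact h.Wbar_modify (k + 1) (by omega) h1
    · rw [h.Wbar_keep (k + 1) (by omega) h1]; exact ih

theorem posDef_bar {m : FunctionModel n} {C : ℝ} {iN : ℕ → ℕ} {J : ℕ → Finset ℕ}
    (h1 : iN 1 = 0) (h : ∀ k, 1 ≤ k → m.MatrixChoice P C (iN k) k (J k)) :
    ∀ k, 1 ≤ k → (m.barP k).PosDef ∧ ∀ j ∈ J k, (m.bar k j).PosDef := by
  have hP : ∀ k, 1 ≤ k → (m.barP k).PosDef := by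
    intro k hk
    induction k, hk using Nat.le_induction with
    | base => exact (h 1 le_rfl).modifyP (by rw [h1]; omega)
    | succ k hk ih =>
      rcases le_or_gt (iN (k + 1)) (P.im + P.il) with h2 | h2
      · exact (h (k + 1) (by omega)).modifyP h2
      · rw [(h (k + 1) (by omega)).keepP h2]; exact ih
  refine fun k hk => ⟨hP k hk, fun j hj => ?_⟩
  -- At equality the bundle matrices already coincide with the aggregate one, which is itself still
  -- freshly modified; no value of `iN` is left uncovered.
  rcases lt_or_ge (iN k) (P.im + P.il) with h2 | h2
  · exact (h k hk).modify h2 j hj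
  · rw [(h k hk).same h2 j hj]; exact hP k hk

theorem posSemidef_aggregate {J : Finset ℕ} {c : ℕ → ℝ} {cP : ℝ} {A : ℕ → Mat n} {AP : Mat n}
    (hc : ∀ j ∈ J, 0 ≤ c j) (hcP : 0 ≤ cP) (hA : ∀ j ∈ J, (A j).PosDef) (hAP : AP.PosDef) :
    Matrix.PosSemidef (aggregate J c cP A AP) :=
  (Matrix.posSemidef_sum J fun j hj => (hA j hj).posSemidef.smul (hc j hj)).add
    (hAP.posSemidef.smul hcP)

theorem posDef_lagrangian (h : I.IsRun P f F O) {k : ℕ} (hk : 1 ≤ k) :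
    (I.Wbar k + I.constraintHess k).PosDef := by
  obtain ⟨h1, h2⟩ := posDef_bar h.init_iN h.obj_matrices k hk
  obtain ⟨h3, h4⟩ := posDef_bar h.init_iN h.con_matrices k hk
  have hm := h.multiplier k hk
  exact (h.posDef_Wbar k hk).add_posSemidef
    ((posSemidef_aggregate (fun j _ => hm.lam_nonneg j) hm.lamP_nonneg h2 h1).add
      (posSemidef_aggregate (fun j _ => hm.mu_nonneg j) hm.muP_nonneg h4 h3))

/-- The objective multipliers sum to `1` and the constraint multipliers to `κ̄^{k+1}`. -/
theorem specNorm_constraintHess_le (h : I.IsRun P f F O) {k : ℕ} (hk : 1 ≤ k) :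
    (I.constraintHess k).specNorm ≤ P.CGbar + I.kbar (k + 1) * P.CGbarhat := by
  have hm := h.multiplier k hk
  have key : ∀ {c : ℕ → ℝ} {cP C : ℝ} {A : ℕ → Mat n} {AP : Mat n}, (∀ j, 0 ≤ c j) → 0 ≤ cP →
      (∀ j ∈ I.J k, (A j).specNorm ≤ C) → AP.specNorm ≤ C →
      Mat.specNorm (aggregate (I.J k) c cP A AP) ≤ (∑ j ∈ I.J k, c j + cP) * C := by
    intro c cP C A AP hc hcP hA hAP
    exact (congrArg norm (map_aggregate (Mat.toCLM n) (I.J k) c cP A AP)).trans_le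
      (norm_aggregate_le (v := fun j => Mat.toCLM n (A j)) (vP := Mat.toCLM n AP)
        (fun j _ => hc j) hcP hA hAP)
  have h1 := key hm.lam_nonneg hm.lamP_nonneg (h.obj_matrices k hk).bound
    (h.obj_matrices k hk).boundP
  have h2 := key hm.mu_nonneg hm.muP_nonneg (h.con_matrices k hk).bound
    (h.con_matrices k hk).boundP
  rw [hm.stationary_v, one_mul] at h1
  rw [← h.kbar_succ k hk] at h2
  exact (Mat.specNorm_add_le _ _).trans (add_le_add h1 h2)

/-- The aggregated gradient of the Lagrangian is controlled by its image under `H_k`. -/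
theorem exists_norm_sq_le (h : I.IsRun P f F O) (hP : P.Valid) {R : ℝ}
    (hR : ∀ k, 1 ≤ k → I.kbar (k + 1) ≤ R)
    (unif : UniformlyPosDef (fun k : ℕ => (I.Wbar k).invSqrt)) :
    ∃ K : ℝ, ∀ k, 1 ≤ k → ∀ z : Vec n, ‖z‖ ^ 2 ≤ K * ‖(I.H k).app z‖ ^ 2 := by
  obtain ⟨c, hc, hu⟩ := unif
  -- The first summand bounds the form of `W̄_p^k`, the bracket that of `B_k`.
  refine ⟨(1 / c) ^ 2 + (P.CGbar + R * P.CGbarhat), fun k hk z => ?_⟩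
  refine Mat.norm_sq_le_of_quad_le (h.posDef_lagrangian hk) (fun v => ?_) z
  have h1 := Mat.quad_le_of_invSqrt (h.posDef_Wbar k hk) hc (hu k hk) v
  have h2 := (I.constraintHess k).quad_le v
  have h3 : (I.constraintHess k).specNorm ≤ P.CGbar + R * P.CGbarhat :=
    (h.specNorm_constraintHess_le hk).trans (by
      have := mul_le_mul_of_nonneg_right (hR k hk) hP.CGbarhat_pos.le
      linarith)
  have h4 := mul_le_mul_of_nonneg_right h3 (sq_nonneg ‖v‖)
  have h5 : Mat.quad (I.Wbar k + I.constraintHess k) v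
      = (I.Wbar k).quad v + (I.constraintHess k).quad v := by
    unfold Mat.quad
    rw [Mat.app_add, inner_add_right]
  rw [h5]
  linarith

end Iterates.IsRun

/-! ### Passage to the limit -/

theorem locError_nonneg (γ ω r s : ℝ) : 0 ≤ locError γ ω r s :=
  (abs_nonneg r).trans (le_max_left _ _)

/-- The error dominates `γ s^ω`; dividing by `γ` and taking the `ω`-th root, legitimate for `s ≥ 0`,
leaves `s`. -/
theorem tendsto_zero_of_locError {ι : Type*} {l : Filter ι} {γ ω : ℝ} (hγ : 0 < γ) (hω : 1 ≤ ω)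
    {r s : ι → ℝ} (hs : ∀ᶠ i in l, 0 ≤ s i)
    (h : Tendsto (fun i => locError γ ω (r i) (s i)) l (𝓝 0)) : Tendsto s l (𝓝 0) := by
  have hω0 : 0 < ω := zero_lt_one.trans_le hω
  have h1 : Tendsto (fun i => s i ^ ω) l (𝓝 0) := by
    have h2 : Tendsto (fun i => locError γ ω (r i) (s i) / γ) l (𝓝 0) := by
      simpa using h.div_const γ
    refine squeeze_zero' (hs.mono fun i hi => Real.rpow_nonneg hi ω) ?_ h2
    filter_upwards with i
    rw [le_div_iff₀ hγ, mul_comm]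
    exact le_max_right _ _
  have h3 := h1.rpow_const (p := ω⁻¹) (Or.inr (inv_nonneg.2 hω0.le))
  rw [Real.zero_rpow (inv_ne_zero hω0.ne')] at h3
  refine h3.congr' ?_
  filter_upwards [hs] with i hi
  rw [← Real.rpow_mul hi, mul_inv_cancel₀ hω0.ne', Real.rpow_one]

theorem Ultrafilter.exists_tendsto_of_norm_le {ι E : Type*} [NormedAddCommGroup E] [ProperSpace E]
    (U : Ultrafilter ι) {u : ι → E} {R : ℝ} (h : ∀ᶠ i in (U : Filter ι), ‖u i‖ ≤ R) :
    ∃ z, Tendsto u U (𝓝 z) := by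
  obtain ⟨z, -, hz⟩ := (isCompact_closedBall (0 : E) R).ultrafilter_le_nhds (U.map u)
    (tendsto_principal.2 (h.mono fun i hi => mem_closedBall_zero_iff.2 hi))
  exact ⟨z, hz⟩

/-- Limits of aggregated gradients with vanishing locality measures satisfy the limiting
subgradient inequality, scaled by the limit of the aggregated weights. -/
theorem FunctionModel.Evolves.inner_lim_le {n : ℕ} {m : FunctionModel n} {x y : ℕ → Vec n}
    {J : ℕ → Finset ℕ} {s c : ℕ → ℕ → ℝ} {cP : ℕ → ℝ} (h : m.Evolves x y J s c cP)
    {f : Vec n → ℝ} (hf : LocallyLipschitz f) {R C : ℝ} (hy : ∀ j, 1 ≤ j → ‖y j‖ ≤ R)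
    (hsub : ∀ j, 1 ≤ j → m.sub j ∈ subdifferential f (y j))
    (hC : ∀ j, 1 ≤ j → Mat.specNorm (m.damp j • m.hess j) ≤ C)
    {l : Filter ℕ} [l.NeBot] (hl : l ≤ atTop) {z g : Vec n} {θ : ℝ}
    (hx : Tendsto x l (𝓝 z))
    (hs : Tendsto (fun k => aggregate (J k) (c k) (cP k) (s k) (m.locP k)) l (𝓝 0))
    (hg : Tendsto (fun k => aggregate (J k) (c k) (cP k) (m.grad k) (m.gradP k)) l (𝓝 g))
    (hθ : Tendsto (fun k => aggregateWeight J c cP (k + 1)) l (𝓝 θ)) (u : Vec n) :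
    inner ℝ g u ≤ θ * clarkeDeriv f z u := by
  -- The constant `K` depends on `a` and may blow up as `a` decreases, so the limit in `k` is taken
  -- for fixed `a`.
  have key : ∀ a, clarkeDeriv f z u < a → inner ℝ g u ≤ θ * a := by
    intro a ha
    obtain ⟨K, hK, hKy⟩ := exists_inner_subgradient_le hf (isCompact_closedBall (0 : Vec n) R) z u ha
    have h1 : ∀ᶠ k in l, inner ℝ (aggregate (J k) (c k) (cP k) (m.grad k) (m.gradP k)) u ≤
        aggregateWeight J c cP (k + 1) * a
          + (K + C * ‖u‖) * aggregate (J k) (c k) (cP k) (s k) (m.locP k) + K * ‖x k - z‖ := by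
      filter_upwards [hl (eventually_ge_atTop 1)] with k hk
      exact h.inner_aggregate_grad_le z u hC hK (fun j hj => hKy _ (by simpa using hy j hj) _
        (hsub j hj)) hk
    have h2 : Tendsto (fun k => ‖x k - z‖) l (𝓝 0) := tendsto_iff_norm_sub_tendsto_zero.1 hx
    have h3 := ((hθ.mul_const a).add (hs.const_mul (K + C * ‖u‖))).add (h2.const_mul K)
    have h4 := le_of_tendsto_of_tendsto (hg.inner tendsto_const_nhds) h3 h1
    simpa using h4
  have h5 : Tendsto (fun a => θ * a) (𝓝[>] (clarkeDeriv f z u)) (𝓝 (θ * clarkeDeriv f z u)) :=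
    ((continuous_const_mul θ).tendsto _).mono_left nhdsWithin_le_nhds
  exact ge_of_tendsto h5 (eventually_mem_nhdsWithin.mono fun a ha => key a ha)

/-- A vanishing `σ` yields an ultrafilter along which `w_k → 0` and `x_k → z`. -/
theorem Iterates.exists_ultrafilter_of_sigma {n : ℕ} {I : Iterates n} {P : Parameters}
    {f F : Vec n → ℝ} {z : Vec n} (hw : ∀ k, 1 ≤ k → 0 < I.w P f F k) (h : I.sigma P f F z = 0) :
    ∃ U : Ultrafilter ℕ, (U : Filter ℕ) ≤ atTop ∧ Tendsto (I.w P f F) U (𝓝 0) ∧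
      Tendsto I.x U (𝓝 z) := by
  -- A nonnegative sequence with lower limit `0` has `0` as a cluster point, and a cluster point is
  -- a limit along some ultrafilter.
  have hcl : MapClusterPt (0 : ℝ) atTop (fun k => max (I.w P f F k) ‖I.x k - z‖) := by
    rw [mapClusterPt_iff_frequently]
    intro s hs
    obtain ⟨ε, hε, hball⟩ := Metric.mem_nhds_iff.1 hs
    have h1 : I.sigma P f F z < (ε : EReal) := by rw [h]; exact_mod_cast hε
    refine (frequently_lt_of_liminf_lt (by isBoundedDefault) h1).mono fun k hk => ?_
    refine hball ?_
    have h2 : max (I.w P f F k) ‖I.x k - z‖ < ε := by exact_mod_cast hk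
    have h3 : 0 ≤ max (I.w P f F k) ‖I.x k - z‖ := le_max_of_le_right (norm_nonneg _)
    rwa [mem_ball_zero_iff, Real.norm_of_nonneg h3]
  obtain ⟨U, hU, hlim⟩ := mapClusterPt_iff_ultrafilter.1 hcl
  refine ⟨U, hU, squeeze_zero' ?_ (Eventually.of_forall fun k => le_max_left _ _) hlim,
    tendsto_iff_norm_sub_tendsto_zero.2
      (squeeze_zero (fun k => norm_nonneg _) (fun k => le_max_right _ _) hlim)⟩
  filter_upwards [hU (eventually_ge_atTop 1)] with k hk using (hw k hk).le

/-- Limits of the aggregated Lagrangian system solve the optimality system. -/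
theorem exists_isStationaryWith {n : ℕ} {f F : Vec n → ℝ} {z g gh : Vec n} {κ θ : ℝ}
    (hne : (subdifferential F z).Nonempty) (hκ : 0 ≤ κ) (hθ : 0 ≤ θ)
    (hg : ∀ u, inner ℝ g u ≤ clarkeDeriv f z u)
    (hgh : 0 < κ → ∀ u, inner ℝ gh u ≤ θ * clarkeDeriv F z u)
    (h0 : g + κ • gh = 0) (hκF : κ * F z = 0) (hF : F z ≤ 0) :
    ∃ κ : ℝ, 0 ≤ κ ∧ IsStationaryWith f F z κ := by
  have hgm := mem_subdifferential hg
  -- With multiplier `0` some element of `∂F` is still needed, because `0 • ∅` is empty.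
  have zero_case : g = 0 → ∃ κ : ℝ, 0 ≤ κ ∧ IsStationaryWith f F z κ := by
    rintro rfl
    obtain ⟨q, hq⟩ := hne
    refine ⟨0, le_rfl, ?_, zero_mul _, hF⟩
    exact Set.mem_add.2 ⟨0, hgm, 0, Set.mem_smul_set.2 ⟨q, hq, zero_smul _ _⟩, add_zero 0⟩
  rcases hκ.eq_or_lt with rfl | hκ
  · exact zero_case (by simpa using h0)
  rcases hθ.eq_or_lt with rfl | hθ
  -- Zero limiting weight: testing with `u = gh` forces `gh = 0`, and then `g = 0`.
  · have h1 := hgh hκ gh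
    rw [zero_mul, real_inner_self_nonpos] at h1
    exact zero_case (by simpa [h1] using h0)
  -- The normalized vector `gh / θ` is a subgradient of `F`, so the weight moves into the
  -- multiplier.
  refine ⟨κ * θ, (mul_pos hκ hθ).le, ?_, by rw [mul_right_comm, hκF, zero_mul], hF⟩
  refine Set.mem_add.2 ⟨g, hgm, κ • gh, Set.mem_smul_set.2 ⟨θ⁻¹ • gh, ?_, ?_⟩, h0⟩
  · refine mem_subdifferential fun u => ?_
    rw [real_inner_smul_left, inv_mul_le_iff₀ hθ]
    exact hgh hκ u
  · rw [smul_smul, mul_assoc, mul_inv_cancel₀ hθ.ne', mul_one]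

/-! ### Convergence to a stationary point -/

theorem mainTheorem3 {n : ℕ} (f F : Vec n → ℝ)
    (hf : LocallyLipschitz f) (hF : LocallyLipschitz F)
    (P : Parameters) (hP : P.Valid) (heps : P.eps = 0)
    (O : Oracle n) (hO : O.Valid f F)
    (I : Iterates n) (hI : I.IsRun P f F O)
    (not_stopped : ∀ k, 1 ≤ k → P.eps < I.w P f F k)
    (bounded : Bornology.IsBounded
      ((fun k : ℕ => (I.x k, I.kbar (k + 1))) '' {k : ℕ | 1 ≤ k}))
    (unif : UniformlyPosDef (fun k : ℕ => (I.Wbar k).invSqrt))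
    (xbar : Vec n) (hsigma : I.sigma P f F xbar = 0) :
    ∃ κ : ℝ, 0 ≤ κ ∧ IsStationaryWith f F xbar κ := by
  rw [heps] at not_stopped
  obtain ⟨U, hU, hw, hx⟩ := Iterates.exists_ultrafilter_of_sigma not_stopped hsigma
  have hU1 : ∀ᶠ k in (U : Filter ℕ), 1 ≤ k := hU (eventually_ge_atTop 1)
  -- bounds
  obtain ⟨R, hR⟩ := bounded.exists_norm_le
  have hRx : ∀ k, 1 ≤ k → ‖I.x k‖ ≤ R := fun k hk =>
    (norm_fst_le (I.x k, I.kbar (k + 1))).trans (hR _ ⟨k, hk, rfl⟩)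
  have hRκ : ∀ k, 1 ≤ k → ‖I.kbar (k + 1)‖ ≤ R := fun k hk =>
    (norm_snd_le (I.x k, I.kbar (k + 1))).trans (hR _ ⟨k, hk, rfl⟩)
  -- One radius, `R + C_S`, serves the iterates and the trial points, which lie within `C_S` of
  -- them.
  have hRx' : ∀ k, 1 ≤ k → ‖I.x k‖ ≤ R + P.CS := fun k hk =>
    (hRx k hk).trans (le_add_of_nonneg_right hP.CS_pos.le)
  have hRy : ∀ k, 1 ≤ k → ‖I.y k‖ ≤ R + P.CS := fun k hk => by
    calc ‖I.y k‖ = ‖I.x k - (I.x k - I.y k)‖ := by rw [sub_sub_cancel]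
      _ ≤ _ := (norm_sub_le _ _).trans (add_le_add (hRx k hk) (hI.norm_x_sub_y_le hP k hk))
  obtain ⟨Cf, hCf⟩ := hI.specNorm_obj_hess_le hP
  obtain ⟨CF, hCF⟩ := hI.specNorm_con_hess_le hP
  have hball := isCompact_closedBall (0 : Vec n) (R + P.CS)
  obtain ⟨Bf, -, hBf⟩ := exists_subgradient_bound hf hball
  obtain ⟨BF, -, hBF⟩ := exists_subgradient_bound hF hball
  obtain ⟨K, hK⟩ := hI.exists_norm_sq_le hP (fun k hk => (le_abs_self _).trans (hRκ k hk)) unif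
  have hef := hI.obj_evolves
  have heF := hI.con_evolves
  -- limits
  obtain ⟨g, hg⟩ := U.exists_tendsto_of_norm_le (u := I.objGrad) (hU1.mono fun k hk =>
    hef.norm_aggregate_grad_le hCf (fun j hj => hBf _ (by simpa using hRy j hj) _
      (hI.obj_sub_mem hO j hj)) hRy hRx' hk)
  obtain ⟨gh, hgh⟩ := U.exists_tendsto_of_norm_le (u := I.conGrad) (hU1.mono fun k hk =>
    heF.norm_aggregate_grad_le hCF (fun j hj => hBF _ (by simpa using hRy j hj) _
      (hI.con_sub_mem hO j hj)) hRy hRx' hk)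
  obtain ⟨κ, hκ⟩ := U.exists_tendsto_of_norm_le (u := fun k => I.kbar (k + 1)) (hU1.mono hRκ)
  have hweight : ∀ k, aggregateWeight I.J I.kap I.kapP (k + 1) ∈ Set.Icc (0 : ℝ) 1 :=
    fun k => heF.aggregateWeight_mem (k + 1) (by omega)
  obtain ⟨θ, hθ⟩ := U.exists_tendsto_of_norm_le
    (u := fun k => aggregateWeight I.J I.kap I.kapP (k + 1)) (R := 1)
    (Eventually.of_forall fun k => by
      rw [Real.norm_of_nonneg (hweight k).1]; exact (hweight k).2)
  have hκ0 : 0 ≤ κ := ge_of_tendsto hκ (hU1.mono fun k hk => hI.kbar_nonneg hk)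
  have hθ0 : 0 ≤ θ := ge_of_tendsto' hθ fun k => (hweight k).1
  -- every summand of `w` tends to zero
  have hterms : ∀ᶠ k in (U : Filter ℕ),
      0 ≤ I.alphaTilde P f k ∧ 0 ≤ I.kbar (k + 1) * I.bigATilde P F k ∧
      0 ≤ I.kbar (k + 1) * (-F (I.x k)) := by
    filter_upwards [hU1] with k hk
    exact ⟨locError_nonneg _ _ _ _, mul_nonneg (hI.kbar_nonneg hk) (locError_nonneg _ _ _ _),
      mul_nonneg (hI.kbar_nonneg hk) (neg_nonneg.2 (hI.feasible_x hP k hk).le)⟩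
  have hα : Tendsto (I.alphaTilde P f) U (𝓝 0) := by
    refine squeeze_zero' (hterms.mono fun k h => h.1) (hterms.mono fun k h => ?_) hw
    unfold Iterates.w
    have := sq_nonneg ‖(I.H k).app (I.objGrad k + I.kbar (k + 1) • I.conGrad k)‖
    linarith [h.2.1, h.2.2]
  have hA : Tendsto (fun k => I.kbar (k + 1) * I.bigATilde P F k) U (𝓝 0) := by
    refine squeeze_zero' (hterms.mono fun k h => h.2.1) (hterms.mono fun k h => ?_) hw
    unfold Iterates.w
    have := sq_nonneg ‖(I.H k).app (I.objGrad k + I.kbar (k + 1) • I.conGrad k)‖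
    linarith [h.1, h.2.2]
  have hκF : Tendsto (fun k => I.kbar (k + 1) * (-F (I.x k))) U (𝓝 0) := by
    refine squeeze_zero' (hterms.mono fun k h => h.2.2) (hterms.mono fun k h => ?_) hw
    unfold Iterates.w
    have := sq_nonneg ‖(I.H k).app (I.objGrad k + I.kbar (k + 1) • I.conGrad k)‖
    linarith [h.1, h.2.1]
  have hH : Tendsto (fun k => ‖(I.H k).app (I.objGrad k + I.kbar (k + 1) • I.conGrad k)‖ ^ 2) U
      (𝓝 0) := by
    have h2 : Tendsto (fun k => 2 * I.w P f F k) U (𝓝 0) := by simpa using hw.const_mul 2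
    refine squeeze_zero' (Eventually.of_forall fun k => sq_nonneg _) (hterms.mono fun k h => ?_) h2
    unfold Iterates.w
    linarith [h.1, h.2.1, h.2.2]
  have hsum : Tendsto (fun k => I.objGrad k + I.kbar (k + 1) • I.conGrad k) U (𝓝 0) := by
    have h1 : Tendsto (fun k => ‖I.objGrad k + I.kbar (k + 1) • I.conGrad k‖ ^ 2) U (𝓝 0) := by
      refine squeeze_zero' (Eventually.of_forall fun k => sq_nonneg _)
        (hU1.mono fun k hk => hK k hk _) ?_
      simpa using hH.const_mul K
    rw [tendsto_zero_iff_norm_tendsto_zero]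
    simpa using h1.sqrt
  have hFx : Tendsto (fun k => F (I.x k)) U (𝓝 (F xbar)) := (hF.continuous.tendsto xbar).comp hx
  -- the limiting system
  have hsf : Tendsto I.objLoc U (𝓝 0) :=
    tendsto_zero_of_locError hP.γ₁_pos hP.one_le_ω₁
      (hU1.mono fun k hk => hef.aggregate_loc_nonneg hk) hα
  -- Only the product `κ̄ Ã` is known to vanish, so `Ã → 0` follows just for a positive limit `κ`;
  -- if `κ = 0`, boundedness of the constraint gradients suffices.
  have hsF : 0 < κ → Tendsto I.conLoc U (𝓝 0) := fun hpos => by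
    refine tendsto_zero_of_locError hP.γ₂_pos hP.one_le_ω₂
      (hU1.mono fun k hk => heF.aggregate_loc_nonneg hk) (r := fun k => F (I.x k) - I.conVal k) ?_
    have h1 := hA.div hκ hpos.ne'
    rw [zero_div] at h1
    refine h1.congr' ?_
    filter_upwards [hκ.eventually (lt_mem_nhds hpos)] with k hk
    exact mul_div_cancel_left₀ _ hk.ne'
  have hone : Tendsto (fun k => aggregateWeight I.J I.lam I.lamP (k + 1)) U (𝓝 1) := by
    refine tendsto_const_nhds.congr fun k => ?_
    exact (aggregateWeight_eq_one (fun k hk => (hI.multiplier k hk).stationary_v) (k + 1)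
      (by omega)).symm
  refine exists_isStationaryWith (g := g) (gh := gh) ⟨_, hO.ghat_mem xbar⟩ hκ0 hθ0 (fun u => ?_)
    (fun hpos u => ?_) ?_ ?_ ?_
  · simpa using hef.inner_lim_le hf hRy (hI.obj_sub_mem hO) hCf hU hx hsf hg hone u
  · exact heF.inner_lim_le hF hRy (hI.con_sub_mem hO) hCF hU hx (hsF hpos) hgh hθ u
  · exact tendsto_nhds_unique (hg.add (hκ.smul hgh)) hsum
  · have h1 := tendsto_nhds_unique (hκ.mul hFx.neg) hκF
    linarith
  · exact le_of_tendsto hFx (hU1.mono fun k hk => (hI.feasible_x hP k hk).le)
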